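/- Let $K$ be a compact metric space and $C(K)$ the Banach space of continuous functions $K\to\mathbb R$ with the sup norm. **Classes of functions.** $B_1(K)$ is the set of functions $F:K\to\mathbb R$ that are pointwise limits of uniformly bounded sequences in $C(K)$. $DBSC(K)$ is the set of $F:K\to\mathbb R$ for which there are $C<\infty$ and $(f_n)_{n\ge 0}\subseteq C(K)$ with $f_0=0$, $f_n\to F$ pointwise, and $\sum_{n\ge 0}|f_{n+1}(k)-f_n(k)|\le C$ for all $k\in K$; $|F|_D$ is the infimum of all such $C\ge 0$. $B_{1/2}(K)$ is the set of $F\in B_1(K)$ that are uniform limits of sequences $(F_n)\subseteq DBSC(K)$, and $B_{1/4}(K)$ is the set of $F\in B_1(K)$ that are uniform limits of sequences $(F_n)\subseteq DBSC(K)$ with $\sup_n|F_n|_D<\infty$. **Identifications.** For a closed linear subspace $X$ of $C(K)$, $X^{**}$ is regarded as a subspace of $C(K)^{**}$, identifying $\psi\in X^{**}$ with $\ell\mapsto\psi(\ell|_X)$. A function $F\in B_1(K)$ is identified with the functional $\Phi\in C(K)^{**}$ that is the weak* limit of a sequence from $C(K)$ and satisfies $\Phi(\delta_k)=F(k)$ for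 all $k\in K$, where $\delta_k$ is evaluation at $k$ (that is, $\Phi(\mu)=\int F\,d\mu$ for finite signed Borel measures $\mu$). **Sequences.** A sequence in a Banach space is *basic* if it is a Schauder basis of its closed linear span, and *seminormalized* if its norms are bounded and bounded away from $0$. A basic sequence $(e_n)$ in some Banach space is a *spreading model* of a seminormalized basic sequence $(x_n)$ if for all $k\in\mathbb N$ and $\varepsilon>0$ there is $N$ such that $$\Bigl|\,\Bigl\|\sum_{i=1}^k a_ix_{n_i}\Bigr\|-\Bigl\|\sum_{i=1}^k a_ie_i\Bigr\|\,\Bigr|<\varepsilon$$ whenever $N<n_1<\dots<n_k$ and $a_1,\dots,a_k\in[-1,1]$. Two sequences $(e_n)$, $(u_n)$ are *equivalent* if there are $0<c,C<\infty$ with $c\|\sum a_iu_i\|\le\|\sum a_ie_i\|\le C\|\sum a_iu_i\|$ for all finitely supported real $(a_i)$. The *summing basis* $(s_n)$ is characterized by $\|\sum a_is_i\|=\sup_k|\sum_{i=1}^k a_i|$. **Corollary 3.10.** Let $X$ be a closed linear subspace of $C(K)$, where $K$ is a compact metric space. (a) If $X^{**}\cap[B_1(K)\setminus B_{1/2}(K)]\ne\emptyset$,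 then $X$ contains a basic sequence with a spreading model equivalent to the unit vector basis of $\ell_1$. (b) If $[X^{**}\cap B_{1/4}(K)]\setminus X\ne\emptyset$, then $X$ contains a basic sequence with a spreading model equivalent to the summing basis. -/

import Mathlib

open Filter Topology

noncomputable section

/-! ### Classes of Baire-1 functions on a compact metric space -/

section Baire

variable {K : Type*} [MetricSpace K] [CompactSpace K]

/-- `B₁(K)`: bounded Baire-1 functions, i.e. pointwise limits of uniformly bounded sequences of
continuous functions. -/
def BaireOne (F : K → ℝ) : Prop :=
  ∃ f : ℕ → C(K, ℝ), (∃ M : ℝ, ∀ n k, |f n k| ≤ M) ∧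
    ∀ k, Tendsto (fun n => f n k) atTop (𝓝 (F k))

/-- `C` is an admissible constant for `F` in the definition of `DBSC(K)` and of `|F|_D`: there are
continuous `f 0 = 0, f 1, f 2, …` converging pointwise to `F` such that
`∑ n, |f (n + 1) k - f n k| ≤ C` for every `k`. -/
def VariationBound (F : K → ℝ) (C : ℝ) : Prop :=
  0 ≤ C ∧ ∃ f : ℕ → C(K, ℝ), f 0 = 0 ∧ (∀ k, Tendsto (fun n => f n k) atTop (𝓝 (F k))) ∧
    ∀ k, Summable (fun n => |f (n + 1) k - f n k|) ∧ ∑' n, |f (n + 1) k - f n k| ≤ C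

/-- `DBSC(K)`: differences of bounded semicontinuous functions. -/
def DBSC (F : K → ℝ) : Prop := ∃ C : ℝ, VariationBound F C

/-- The norm `|F|_D` (meaningful for `F` in `DBSC(K)`). -/
def dNorm (F : K → ℝ) : ℝ := sInf {C : ℝ | VariationBound F C}

/-- `B_{1/2}(K)`: Baire-1 functions that are uniform limits of sequences in `DBSC(K)`. -/
def BaireHalf (F : K → ℝ) : Prop :=
  BaireOne F ∧ ∃ G : ℕ → K → ℝ, (∀ n, DBSC (G n)) ∧ TendstoUniformly G F atTop

/-- `B_{1/4}(K)`: Baire-1 functions that are uniform limits of sequences in `DBSC(K)` which are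
bounded in the norm `|·|_D`. -/
def BaireQuarter (F : K → ℝ) : Prop :=
  BaireOne F ∧ ∃ G : ℕ → K → ℝ, (∀ n, DBSC (G n)) ∧
    BddAbove (Set.range fun n => dNorm (G n)) ∧ TendstoUniformly G F atTop

/-- The natural identification of `B₁(C(K)) ⊆ C(K)**` with `B₁(K)`: the functional `Φ` is the weak*
limit of a sequence in `C(K)`, and it corresponds to the function `F k = Φ(δ_k)`, where `δ_k` is
evaluation at `k`. (Equivalently, `F` is in `B₁(K)` and `Φ(μ) = ∫ F dμ` for every finite signed
Borel measure `μ`.) -/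
def CorrespondsTo (Φ : StrongDual ℝ (StrongDual ℝ C(K, ℝ))) (F : K → ℝ) : Prop :=
  (∃ f : ℕ → C(K, ℝ), ∀ ℓ : StrongDual ℝ C(K, ℝ),
    Tendsto (fun n => ℓ (f n)) atTop (𝓝 (Φ ℓ))) ∧
  ∀ k, Φ (ContinuousMap.evalCLM ℝ k) = F k

/-- The function `F` belongs to `X** ∩ B₁(K)`: some `ψ ∈ X**`, regarded as an element
`ℓ ↦ ψ (ℓ|X)` of `C(K)**`, corresponds to `F`. -/
def MemBidual (X : Submodule ℝ C(K, ℝ)) (F : K → ℝ) : Prop :=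
  ∃ (ψ : StrongDual ℝ (StrongDual ℝ X)) (Φ : StrongDual ℝ (StrongDual ℝ C(K, ℝ))),
    (∀ ℓ : StrongDual ℝ C(K, ℝ), Φ ℓ = ψ (ℓ.comp X.subtypeL)) ∧ CorrespondsTo Φ F

end Baire

/-! ### Basic sequences and spreading models -/

section Sequences

variable {E E' : Type*} [NormedAddCommGroup E] [NormedSpace ℝ E]
  [NormedAddCommGroup E'] [NormedSpace ℝ E']

/-- `x` is a basic sequence: it is a Schauder basis of its closed linear span. -/
def IsBasicSequence (x : ℕ → E) : Prop :=
  ∃ b : SchauderBasis ℝ (Submodule.span ℝ (Set.range x)).topologicalClosure,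
    ∀ n, (b n : E) = x n

/-- `x` is seminormalized: `0 < inf ‖x n‖` and `sup ‖x n‖ < ∞`. -/
def IsSeminormalized (x : ℕ → E) : Prop :=
  ∃ c C : ℝ, 0 < c ∧ ∀ n, c ≤ ‖x n‖ ∧ ‖x n‖ ≤ C

/-- The basic sequence `e` is a spreading model of the seminormalized basic sequence `x`. -/
structure IsSpreadingModel (x : ℕ → E) (e : ℕ → E') : Prop where
  basic_left : IsBasicSequence x
  seminormalized : IsSeminormalized x
  basic_right : IsBasicSequence e
  asymptotic : ∀ (k : ℕ) (ε : ℝ), 0 < ε → ∃ N : ℕ, ∀ n : Fin k → ℕ, StrictMono n →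
    (∀ i, N < n i) → ∀ a : Fin k → ℝ, (∀ i, |a i| ≤ 1) →
      |‖∑ i, a i • x (n i)‖ - ‖∑ i, a i • e i‖| < ε

/-- Equivalence of two sequences in normed spaces. -/
def SeqEquivalent (e : ℕ → E) (u : ℕ → E') : Prop :=
  ∃ c C : ℝ, 0 < c ∧ 0 < C ∧ ∀ (n : ℕ) (a : ℕ → ℝ),
    c * ‖∑ i ∈ Finset.range n, a i • u i‖ ≤ ‖∑ i ∈ Finset.range n, a i • e i‖ ∧
    ‖∑ i ∈ Finset.range n, a i • e i‖ ≤ C * ‖∑ i ∈ Finset.range n, a i • u i‖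

/-- The sequence `x` has a spreading model, in some Banach space, that is equivalent to `u`. -/
def HasSpreadingModelEquivalentTo (x : ℕ → E) (u : ℕ → E') : Prop :=
  ∃ (S : Type) (_ : NormedAddCommGroup S) (_ : NormedSpace ℝ S) (_ : CompleteSpace S)
    (e : ℕ → S), IsSpreadingModel x e ∧ SeqEquivalent e u

end Sequences

/-- The unit vector basis of `ℓ₁`. -/
def ellOneBasis (n : ℕ) : lp (fun _ : ℕ => ℝ) 1 := lp.single 1 n (1 : ℝ)

/-- The summing basis, realized in the bounded sequences with the sup norm: `s n` is the indicator
function of `{k | n ≤ k}`. -/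
def summingBasis (n : ℕ) : BoundedContinuousFunction ℕ ℝ :=
  BoundedContinuousFunction.ofNormedAddCommGroupDiscrete
    (fun k => if n ≤ k then (1 : ℝ) else 0) 1 (by intro k; split_ifs <;> simp)

/-- The characterization of the summing basis: `‖∑ aᵢ sᵢ‖ = sup_k |∑_{i ≤ k} aᵢ|`. -/
theorem norm_sum_summingBasis (n : ℕ) (a : ℕ → ℝ) :
    ‖∑ i ∈ Finset.range n, a i • summingBasis i‖ =
      ⨆ k : ℕ, |∑ i ∈ Finset.range n with i ≤ k, a i| := by
  rw [BoundedContinuousFunction.norm_eq_iSup_norm]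
  congr 1
  funext k
  rw [Real.norm_eq_abs, BoundedContinuousFunction.sum_apply, Finset.sum_filter]
  congr 1
  refine Finset.sum_congr rfl fun i _ => ?_
  simp [summingBasis]

end

/-! Both parts start from a bounded sequence in `X` converging pointwise to `F`. Hahn–Banach
separation shows that the convex hulls of the tails of a weak* approximating sequence come close to
a fixed ball of `X` (`MemBidual.exists_seq`). If `F` is discontinuous, a subsequence dominates the
summing basis and has uniformly bounded initial-segment projections
(`exists_strictMono_prefixBound`), hence is basic by Grünblum's criterion. A Brunel–Sucheston
argument then extracts a spreading model whose norms are limits of norms of shifted combinations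
(`exists_spreadingModel`). So an estimate on all sufficiently late finite pieces of the sequence
passes to the spreading model, and it remains to find such estimates.

(a) For levels `a < b`, iterate the derivation that keeps the limits common to `{F ≤ a}` and `{F ≥
b}`. If it dies after finitely many steps for every pair of levels, alternating sums of indicators
of closed sets separate the levels, and slicing the range shows that `F` is in `B_{1/2}`. Otherwise
some pair has nonempty derived sets of every finite order, and climbing down them makes late finite
pieces Boolean independent (`iterEventually_independentAt`). Rosenthal's two-point estimate then
gives a lower `ℓ₁` bound; boundedness gives the upper one.

(b) If `F` were continuous it would lie in `X`, by a Mazur argument, so `F` is discontinuous and the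
lower summing estimate holds. For the upper one, convex blocks of the sequence are taken uniformly
close to the same blocks of approximants with uniformly bounded variation. At each point such
approximants are differences of bounded monotone sequences, and Abel summation bounds their
combinations by the partial sums of the coefficients (`BaireQuarter.exists_late_summing_upper`). -/

noncomputable section

/-! ### Grünblum's criterion -/

section Grunblum

variable {E : Type*} [NormedAddCommGroup E] [NormedSpace ℝ E]

/-- The initial-segment projections on the span of `x` are bounded by `C`. -/
def PrefixBound (x : ℕ → E) (C : ℝ) : Prop :=
  ∀ (a : ℕ → ℝ) (m N : ℕ), m ≤ N →
    ‖∑ i ∈ Finset.range m, a i • x i‖ ≤ C * ‖∑ i ∈ Finset.range N, a i • x i‖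

theorem Finsupp.exists_linearCombination_eq_sum_range (l : ℕ →₀ ℝ) :
    ∃ N₀, ∀ N, N₀ ≤ N → ∀ {V : Type*} [AddCommGroup V] [Module ℝ V] (x : ℕ → V),
      Finsupp.linearCombination ℝ x l = ∑ i ∈ Finset.range N, l i • x i := by
  obtain ⟨N₀, hN₀⟩ := l.support.exists_nat_subset_range
  refine ⟨N₀, fun N hN V _ _ x => ?_⟩
  rw [Finsupp.linearCombination_apply]
  exact Finsupp.sum_of_support_subset _
    (hN₀.trans (Finset.range_mono hN)) _ (by simp)

theorem PrefixBound.abs_coeff_mul_norm_le {x : ℕ → E} {C : ℝ} (h : PrefixBound x C)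
    (a : ℕ → ℝ) {j N : ℕ} (hj : j < N) :
    |a j| * ‖x j‖ ≤ 2 * C * ‖∑ i ∈ Finset.range N, a i • x i‖ := by
  have h1 := h a (j + 1) N hj
  have h2 := h a j N hj.le
  have h3 : a j • x j = ∑ i ∈ Finset.range (j + 1), a i • x i - ∑ i ∈ Finset.range j, a i • x i := by
    rw [Finset.sum_range_succ]; abel
  have h4 : |a j| * ‖x j‖ = ‖a j • x j‖ := by rw [norm_smul, Real.norm_eq_abs]
  rw [h4, h3]
  refine (norm_sub_le _ _).trans ?_
  linarith

theorem PrefixBound.abs_coeff_mul_norm_le_linearCombination {x : ℕ → E} {C : ℝ}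
    (h : PrefixBound x C) (l : ℕ →₀ ℝ) (j : ℕ) :
    |l j| * ‖x j‖ ≤ 2 * C * ‖Finsupp.linearCombination ℝ x l‖ := by
  obtain ⟨N₁, hN₁⟩ := Finsupp.exists_linearCombination_eq_sum_range l
  rw [hN₁ (max N₁ (j + 1)) (le_max_left _ _) x]
  exact h.abs_coeff_mul_norm_le l (lt_of_lt_of_le (Nat.lt_succ_self j) (le_max_right _ _))

theorem PrefixBound.linearIndependent {x : ℕ → E} {C : ℝ} (h : PrefixBound x C)
    (h0 : ∀ n, x n ≠ 0) : LinearIndependent ℝ x := by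
  refine linearIndependent_iff.2 fun l hl => Finsupp.ext fun j => ?_
  have := h.abs_coeff_mul_norm_le_linearCombination l j
  rw [hl, norm_zero, mul_zero] at this
  have h2 : 0 < ‖x j‖ := norm_pos_iff.2 (h0 j)
  have : |l j| ≤ 0 := by
    by_contra hc
    push Not at hc
    have := mul_pos hc h2
    linarith
  simpa using this

/-- A single term is a difference of two consecutive prefixes, so the `j`-th coefficient is bounded
on the span; Hahn–Banach extends it to the whole space. -/
theorem PrefixBound.exists_coord {x : ℕ → E} {C : ℝ} (h : PrefixBound x C)
    (h0 : ∀ n, x n ≠ 0) (j : ℕ) :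
    ∃ f : StrongDual ℝ E, ∀ i, f (x i) = (Pi.single i (1 : ℝ) : ℕ → ℝ) j := by
  have hli := h.linearIndependent h0
  let g : Submodule.span ℝ (Set.range x) →ₗ[ℝ] ℝ := (Finsupp.lapply j).comp hli.repr
  have hg : ∀ z, ‖g z‖ ≤ (2 * C / ‖x j‖) * ‖z‖ := by
    intro z
    have h1 := h.abs_coeff_mul_norm_le_linearCombination (hli.repr z) j
    rw [hli.linearCombination_repr] at h1
    have h2 : 0 < ‖x j‖ := norm_pos_iff.2 (h0 j)
    rw [div_mul_eq_mul_div, le_div_iff₀ h2]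
    exact h1
  obtain ⟨f, hf, -⟩ := exists_extension_norm_eq _ (g.mkContinuous _ hg)
  refine ⟨f, fun i => ?_⟩
  have hi : x i ∈ Submodule.span ℝ (Set.range x) := Submodule.subset_span ⟨i, rfl⟩
  have := hf ⟨x i, hi⟩
  simp only [LinearMap.mkContinuous_apply] at this
  rw [this]
  change (hli.repr ⟨x i, hi⟩) j = _
  rw [hli.repr_eq_single i ⟨x i, hi⟩ rfl, Finsupp.single_eq_pi_single]

/-- The partial-sum operators are bounded by `C` on the span, hence on its closure. They eventually
fix each vector of the span, so by density they converge pointwise to the identity on the closure.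
-/
theorem PrefixBound.isBasicSequence {x : ℕ → E} {C : ℝ} (h : PrefixBound x C)
    (h0 : ∀ n, x n ≠ 0) : IsBasicSequence x := by
  classical
  choose f hf using h.exists_coord h0
  set Y := (Submodule.span ℝ (Set.range x)).topologicalClosure with hY
  have hxY : ∀ i, x i ∈ Y := fun i =>
    Submodule.le_topologicalClosure _ (Submodule.subset_span ⟨i, rfl⟩)
  let P : ℕ → E →L[ℝ] E := fun n => ∑ i ∈ Finset.range n, (f i).smulRight (x i)
  have hP : ∀ n z, P n z = ∑ i ∈ Finset.range n, f i z • x i := fun n z => by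
    simp [P]
  have hfl : ∀ (l : ℕ →₀ ℝ) j, f j (Finsupp.linearCombination ℝ x l) = l j := by
    intro l j
    obtain ⟨N₁, hN₁⟩ := Finsupp.exists_linearCombination_eq_sum_range l
    rw [hN₁ (max N₁ (j + 1)) (le_max_left _ _) x, map_sum]
    simp only [map_smul, hf, Pi.single_apply, smul_eq_mul, mul_ite, mul_one, mul_zero]
    rw [Finset.sum_ite_eq, if_pos]
    simp
  have hspan : ∀ z ∈ Submodule.span ℝ (Set.range x), (∀ n, ‖P n z‖ ≤ C * ‖z‖) ∧
      ∀ᶠ n in atTop, P n z = z := by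
    intro z hz
    obtain ⟨l, rfl⟩ := (Finsupp.mem_span_range_iff_exists_finsupp).1 hz
    change (∀ n, ‖P n (Finsupp.linearCombination ℝ x l)‖ ≤
      C * ‖Finsupp.linearCombination ℝ x l‖) ∧
      ∀ᶠ n in atTop, P n (Finsupp.linearCombination ℝ x l) = Finsupp.linearCombination ℝ x l
    obtain ⟨N₁, hN₁⟩ := Finsupp.exists_linearCombination_eq_sum_range l
    constructor
    · intro n
      rw [hP]
      simp only [hfl]
      rw [hN₁ (max N₁ n) (le_max_left _ _) x]
      exact h _ _ _ (le_max_right _ _)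
    · filter_upwards [eventually_ge_atTop N₁] with n hn
      rw [hP]
      simp only [hfl]
      rw [hN₁ n hn x]
  have hbound : ∀ z ∈ Y, ∀ n, ‖P n z‖ ≤ C * ‖z‖ := by
    intro z hz n
    have hcl : IsClosed {z | ‖P n z‖ ≤ C * ‖z‖} :=
      isClosed_le (by fun_prop) (by fun_prop)
    exact closure_minimal (fun z hz => (hspan z hz).1 n) hcl hz
  have hC : 0 ≤ C := by
    have := h (fun _ => 1) 0 1 (Nat.zero_le _)
    simp only [Finset.range_zero, Finset.sum_empty, norm_zero, Finset.range_one,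
      Finset.sum_singleton, one_smul] at this
    exact nonneg_of_mul_nonneg_left this (norm_pos_iff.2 (h0 0))
  have hconv : ∀ z ∈ Y, Tendsto (fun n => P n z) atTop (𝓝 z) := by
    intro z hz
    rw [Metric.tendsto_atTop]
    intro ε hε
    obtain ⟨w, hw, hzw⟩ := Metric.mem_closure_iff.1 hz (ε / (C + 2)) (by positivity)
    obtain ⟨N, hN⟩ := eventually_atTop.1 (hspan w hw).2
    refine ⟨N, fun n hn => ?_⟩
    have h1 : ‖P n (z - w)‖ ≤ C * ‖z - w‖ :=
      hbound _ (Y.sub_mem hz (Submodule.le_topologicalClosure _ hw)) n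
    rw [dist_eq_norm] at hzw ⊢
    have h2 : P n z - z = P n (z - w) - (z - w) := by rw [map_sub, hN n hn]; abel
    rw [h2]
    refine lt_of_le_of_lt (norm_sub_le _ _) ?_
    rw [lt_div_iff₀ (by positivity)] at hzw
    nlinarith [norm_nonneg (z - w)]
  refine ⟨⟨fun i => ⟨x i, hxY i⟩, fun i => (f i).comp Y.subtypeL, ?_, ?_⟩, fun n => rfl⟩
  · intro i j
    have := hf i j
    simp only [Pi.single_apply] at this ⊢
    rw [show ((f i).comp Y.subtypeL) ⟨x j, hxY j⟩ = f i (x j) from rfl, this]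
    congr
  · intro z
    rw [HasSum, SummationFilter.conditional_filter_eq_map_range, tendsto_map'_iff,
      tendsto_subtype_rng]
    refine (hconv z z.2).congr fun n => ?_
    simp [hP]

/-- Padding the coefficients by zero off the range of `φ` transfers estimates from a sequence to its
subsequences. -/
theorem sum_range_comp_eq_sum_extend {V : Type*} [AddCommGroup V] [Module ℝ V] {φ : ℕ → ℕ}
    (hφ : StrictMono φ) (x : ℕ → V) (a : ℕ → ℝ) (m : ℕ) :
    ∑ i ∈ Finset.range m, a i • x (φ i) =
      ∑ j ∈ Finset.range (φ m), Function.extend φ a 0 j • x j := by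
  classical
  have h1 : ∑ i ∈ Finset.range m, a i • x (φ i) =
      ∑ j ∈ (Finset.range m).image φ, Function.extend φ a 0 j • x j := by
    rw [Finset.sum_image hφ.injective.injOn]
    exact Finset.sum_congr rfl fun i _ => by rw [hφ.injective.extend_apply]
  rw [h1]
  refine Finset.sum_subset ?_ ?_
  · intro j hj
    obtain ⟨i, hi, rfl⟩ := Finset.mem_image.1 hj
    exact Finset.mem_range.2 (hφ (Finset.mem_range.1 hi))
  · intro j hj hj'
    by_cases hr : ∃ i, φ i = j
    · obtain ⟨i, rfl⟩ := hr
      exact absurd (Finset.mem_image_of_mem φ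
        (Finset.mem_range.2 (hφ.lt_iff_lt.1 (Finset.mem_range.1 hj)))) hj'
    · rw [Function.extend_apply' _ _ _ hr]; simp

theorem PrefixBound.comp {x : ℕ → E} {C : ℝ} (h : PrefixBound x C) {φ : ℕ → ℕ}
    (hφ : StrictMono φ) : PrefixBound (x ∘ φ) C := by
  intro a m N hmN
  simp only [Function.comp_apply]
  rw [sum_range_comp_eq_sum_extend hφ, sum_range_comp_eq_sum_extend hφ]
  exact h _ _ _ (hφ.monotone hmN)

end Grunblum

/-! ### Iterated limits along a filter and Ramsey-type selection -/

section Selection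

/-- `P (s ∪ {n₁, …, nᵣ})` holds for almost all `n₁`, almost all `n₂`, …, almost all `nᵣ`. -/
def IterEventually (u : Filter ℕ) (P : Finset ℕ → Prop) : ℕ → Finset ℕ → Prop
  | 0, s => P s
  | r + 1, s => ∀ᶠ n in u, IterEventually u P r (insert n s)

variable {u : Filter ℕ}

theorem IterEventually.mono {P Q : Finset ℕ → Prop} (hPQ : ∀ s, P s → Q s) :
    ∀ {r : ℕ} {s : Finset ℕ}, IterEventually u P r s → IterEventually u Q r s
  | 0, _, h => hPQ _ h
  | _ + 1, _, h => Eventually.mono h fun _ hn => IterEventually.mono hPQ hn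

theorem IterEventually.and {P Q : Finset ℕ → Prop} : ∀ {r : ℕ} {s : Finset ℕ},
    IterEventually u P r s → IterEventually u Q r s →
      IterEventually u (fun t => P t ∧ Q t) r s
  | 0, _, h, h' => ⟨h, h'⟩
  | _ + 1, _, h, h' => Eventually.mp h (Eventually.mono h' fun _ hn hn' => hn'.and hn)

theorem iterEventually_of_forall {P : Finset ℕ → Prop} (h : ∀ s, P s) :
    ∀ (r : ℕ) (s : Finset ℕ), IterEventually u P r s
  | 0, s => h s
  | r + 1, _ => Eventually.of_forall fun _ => iterEventually_of_forall h r _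

theorem iterEventually_forall_finset {ι : Type*} {P : ι → Finset ℕ → Prop} {r : ℕ}
    {s : Finset ℕ} (I : Finset ι) (h : ∀ i ∈ I, IterEventually u (P i) r s) :
    IterEventually u (fun t => ∀ i ∈ I, P i t) r s := by
  classical
  induction I using Finset.induction_on with
  | empty => exact iterEventually_of_forall (by simp) r s
  | insert i I _ ih =>
    refine ((h i (Finset.mem_insert_self _ _)).and
      (ih fun j hj => h j (Finset.mem_insert_of_mem hj))).mono fun t ht j hj => ?_
    rcases Finset.mem_insert.1 hj with rfl | hj
    · exact ht.1
    · exact ht.2 j hj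

/-- The number `c` is the iterated ultralimit of `g`, which exists because `[-M, M]` is compact. -/
theorem exists_iterEventually_abs_sub_lt (u : Ultrafilter ℕ) {g : Finset ℕ → ℝ} {M : ℝ}
    (hg : ∀ s, |g s| ≤ M) (r : ℕ) (s : Finset ℕ) :
    ∃ c, |c| ≤ M ∧ ∀ ε > 0, IterEventually u (fun t => |g t - c| < ε) r s := by
  classical
  induction r generalizing s with
  | zero => exact ⟨g s, hg s, fun ε hε => by simpa [IterEventually] using hε⟩
  | succ r ih =>
    choose c hcM hc using fun n => ih (insert n s)
    obtain ⟨d, hd, hcd⟩ := (isCompact_Icc (a := -M) (b := M)).ultrafilter_le_nhds (u.map c)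
      (by
        rw [le_principal_iff]
        exact Eventually.of_forall (f := (u : Filter ℕ)) fun n => abs_le.1 (hcM n))
    refine ⟨d, abs_le.2 hd, fun ε hε => ?_⟩
    have h1 : ∀ᶠ n in (u : Filter ℕ), |c n - d| < ε / 2 :=
      hcd (Metric.ball_mem_nhds d (half_pos hε))
    refine h1.mono fun n hn => (hc n (ε / 2) (half_pos hε)).mono fun t ht => ?_
    have := abs_sub_le (g t) (c n) d
    linarith

theorem exists_seq_of_forall_finset (R : Finset ℕ → ℕ → Prop) (h : ∀ A, ∃ n, R A n) :
    ∃ φ : ℕ → ℕ, ∀ j, R ((Finset.range j).image φ) (φ j) := by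
  classical
  choose f hf using h
  let A : ℕ → Finset ℕ := fun j => Nat.rec ∅ (fun _ B => insert (f B) B) j
  have hA : ∀ j, A j = (Finset.range j).image fun i => f (A i) := by
    intro j
    induction j with
    | zero => rfl
    | succ j ih =>
      rw [Finset.range_add_one, Finset.image_insert, ← ih]
  exact ⟨fun j => f (A j), fun j => by rw [← hA]; exact hf _⟩

/-- Countably many properties, each holding iteratedly along `u`, hold simultaneously along a
subsequence: the `j`-th one for all sets of `k j` terms with indices at least `j`. -/
theorem exists_strictMono_forall_of_iterEventually [u.NeBot] (hu : u ≤ atTop)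
    (P : ℕ → Finset ℕ → Prop) (k : ℕ → ℕ) (h : ∀ j, IterEventually u (P j) (k j) ∅) :
    ∃ φ : ℕ → ℕ, StrictMono φ ∧ ∀ j, ∀ I : Finset ℕ, I.card = k j → (∀ i ∈ I, j ≤ i) →
      P j (I.image φ) := by
  classical
  -- The new term must exceed the earlier ones and preserve every pending property for every set `s`
  -- of earlier terms. Only `j ≤ A.card` is considered, which leaves finitely many eventual
  -- conditions; this is why the `j`-th property concerns indices from `j` on.
  obtain ⟨φ, hφ⟩ := exists_seq_of_forall_finset
    (fun A n => (∀ m ∈ A, m < n) ∧ ∀ j ∈ Finset.range (A.card + 1), ∀ s ∈ A.powerset,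
      ∀ r ∈ Finset.range (k j), IterEventually u (P j) (r + 1) s →
        IterEventually u (P j) r (insert n s)) fun A => by
    refine Eventually.exists (f := u) (Eventually.and ?_ ?_)
    · rw [Finset.eventually_all]
      exact fun m _ => hu (eventually_gt_atTop m)
    · simp only [Finset.eventually_all]
      intro j _ s _ r _
      by_cases hs : IterEventually u (P j) (r + 1) s
      · exact Eventually.mono hs fun n hn _ => hn
      · exact Eventually.of_forall fun n hn => absurd hn hs
  have hmono : StrictMono φ := strictMono_nat_of_lt_succ fun n =>
    (hφ (n + 1)).1 _ (Finset.mem_image_of_mem φ (by simp))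
  refine ⟨φ, hmono, fun j => ?_⟩
  have key : ∀ I : Finset ℕ, ∀ r, I.card + r = k j → (∀ i ∈ I, j ≤ i) →
      IterEventually u (P j) r (I.image φ) := by
    intro I
    induction I using Finset.induction_on_max with
    | empty =>
      intro r hr _
      have := h j
      rw [← hr] at this
      simpa using this
    | insert m I hm ih =>
      intro r hr hj
      have hmI : m ∉ I := fun hmem => lt_irrefl _ (hm m hmem)
      rw [Finset.card_insert_of_notMem hmI] at hr
      rw [Finset.image_insert]
      refine (hφ m).2 j ?_ _ ?_ r ?_ (ih (r + 1) (by omega) fun i hi =>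
        hj i (Finset.mem_insert_of_mem hi))
      · rw [Finset.card_image_of_injective _ hmono.injective, Finset.card_range,
          Finset.mem_range]
        exact Nat.lt_succ_of_le (hj m (Finset.mem_insert_self _ _))
      · rw [Finset.mem_powerset]
        exact Finset.image_subset_image fun i hi => Finset.mem_range.2 (hm i hi)
      · rw [Finset.mem_range]; omega
  exact fun I hI hj => key I 0 (by simpa using hI) hj

end Selection

/-! ### Existence of spreading models -/

universe u

section Spreading

variable {E : Type*} [NormedAddCommGroup E] [NormedSpace ℝ E]

/-- A seminorm is induced by a linear map into a Banach space. -/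
theorem Seminorm.exists_banach_linearMap_norm_eq {V : Type u} [AddCommGroup V] [Module ℝ V]
    (p : Seminorm ℝ V) :
    ∃ (S : Type u) (_ : NormedAddCommGroup S) (_ : NormedSpace ℝ S) (_ : CompleteSpace S)
      (T : V →ₗ[ℝ] S), ∀ v, ‖T v‖ = p v := by
  let : SeminormedAddCommGroup V := p.toAddGroupSeminorm.toSeminormedAddCommGroup
  let : NormedSpace ℝ V := { norm_smul_le := fun a v => (map_smul_eq_mul p a v).le }
  exact ⟨UniformSpace.Completion V, inferInstance, inferInstance, inferInstance,
    (UniformSpace.Completion.toComplₗᵢ (𝕜 := ℝ) (E := V)).toLinearMap,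
    fun v => UniformSpace.Completion.norm_coe v⟩

theorem norm_sum_smul_le {ι : Type*} (I : Finset ι) {x : ι → E} {M : ℝ} (hM : ∀ i ∈ I, ‖x i‖ ≤ M)
    (a : ι → ℝ) : ‖∑ i ∈ I, a i • x i‖ ≤ (∑ i ∈ I, |a i|) * M := by
  rw [Finset.sum_mul]
  refine norm_sum_le_of_le _ fun i hi => ?_
  rw [norm_smul, Real.norm_eq_abs]
  exact mul_le_mul_of_nonneg_left (hM i hi) (abs_nonneg _)

/-- The norm of the combination with coefficients `a` of the terms of `x` indexed by `s`. -/
def combNorm (x : ℕ → E) {k : ℕ} (a : Fin k → ℝ) (s : Finset ℕ) : ℝ :=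
  if h : s.card = k then ‖∑ i, a i • x (s.orderEmbOfFin h i)‖ else 0

theorem combNorm_image (x : ℕ → E) {k : ℕ} (a : Fin k → ℝ) {n : Fin k → ℕ} (hn : StrictMono n) :
    combNorm x a (Finset.univ.image n) = ‖∑ i, a i • x (n i)‖ := by
  have h : (Finset.univ.image n).card = k := by
    rw [Finset.card_image_of_injective _ hn.injective, Finset.card_univ, Fintype.card_fin]
  rw [combNorm, dif_pos h,
    ← Finset.orderEmbOfFin_unique h (fun i => Finset.mem_image_of_mem _ (Finset.mem_univ i)) hn]

theorem abs_combNorm_le {x : ℕ → E} {M : ℝ} (hM : ∀ n, ‖x n‖ ≤ M) {k : ℕ} (a : Fin k → ℝ)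
    (s : Finset ℕ) : |combNorm x a s| ≤ (∑ i, |a i|) * M := by
  have hM0 : 0 ≤ M := (norm_nonneg _).trans (hM 0)
  unfold combNorm
  split_ifs with h
  · rw [abs_norm]
    exact norm_sum_smul_le _ (fun i _ => hM _) a
  · rw [abs_zero]; positivity

/-- For each coefficient vector the norms have an iterated ultralimit. Finite nets of the
coefficient cube reduce the requirements to countably many, coded by pairs (length `k`, precision
`m`), and one subsequence meets them all. -/
theorem exists_strictMono_asymptotically_spreading {x : ℕ → E} {M : ℝ} (hM : ∀ n, ‖x n‖ ≤ M) :
    ∃ φ : ℕ → ℕ, StrictMono φ ∧ ∀ (k : ℕ) (ε : ℝ), 0 < ε → ∃ N : ℕ, ∀ n n' : Fin k → ℕ,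
      StrictMono n → StrictMono n' → (∀ i, N ≤ n i) → (∀ i, N ≤ n' i) →
      ∀ a : Fin k → ℝ, (∀ i, |a i| ≤ 1) →
        |‖∑ i, a i • x (φ (n i))‖ - ‖∑ i, a i • x (φ (n' i))‖| ≤ ε := by
  classical
  have hM0 : 0 ≤ M := (norm_nonneg _).trans (hM 0)
  have hnet : ∀ k m : ℕ, ∃ A : Finset (Fin k → ℝ), ∀ a : Fin k → ℝ, (∀ i, |a i| ≤ 1) →
      ∃ b ∈ A, ∀ i, |a i - b i| ≤ 1 / ((m : ℝ) + 1) := by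
    intro k m
    obtain ⟨t, -, ht, hcov⟩ := (isCompact_closedBall (0 : Fin k → ℝ) 1).finite_cover_balls
      (e := 1 / ((m : ℝ) + 1)) (by positivity)
    refine ⟨ht.toFinset, fun a ha => ?_⟩
    have hmem : a ∈ Metric.closedBall (0 : Fin k → ℝ) 1 := by
      rw [mem_closedBall_zero_iff, pi_norm_le_iff_of_nonneg zero_le_one]
      exact ha
    obtain ⟨b, hb, hab⟩ := Set.mem_iUnion₂.1 (hcov hmem)
    refine ⟨b, ht.mem_toFinset.2 hb, fun i => ?_⟩
    rw [Metric.mem_ball, dist_eq_norm] at hab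
    exact (norm_le_pi_norm (a - b) i).trans hab.le
  choose A hA using hnet
  have hlim : ∀ (k : ℕ) (a : Fin k → ℝ), ∃ c : ℝ, ∀ ε > 0,
      IterEventually (hyperfilter ℕ : Filter ℕ) (fun s => |combNorm x a s - c| < ε) k ∅ :=
    fun k a => by
      obtain ⟨c, -, hc⟩ := exists_iterEventually_abs_sub_lt (hyperfilter ℕ)
        (abs_combNorm_le hM a) k ∅
      exact ⟨c, hc⟩
  choose c hc using hlim
  obtain ⟨φ, hφ, hP⟩ := exists_strictMono_forall_of_iterEventually
    (u := (hyperfilter ℕ : Filter ℕ)) Nat.hyperfilter_le_atTop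
    (fun j s => ∀ b ∈ A j.unpair.1 j.unpair.2,
      |combNorm x b s - c _ b| < 1 / ((j.unpair.2 : ℝ) + 1))
    (fun j => j.unpair.1)
    (fun j => iterEventually_forall_finset _ fun b _ => hc _ b _ (by positivity))
  refine ⟨φ, hφ, fun k ε hε => ?_⟩
  -- Each of the two norms costs `k * M / (m + 1)` for moving `a` to the net and `1 / (m + 1)` for
  -- comparison with the limit.
  obtain ⟨m, hm⟩ := exists_nat_gt ((2 + 2 * k * M) / ε)
  have hm' : (2 + 2 * k * M) * (1 / ((m : ℝ) + 1)) ≤ ε := by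
    rw [mul_one_div, div_le_iff₀ (by positivity)]
    rw [div_lt_iff₀ hε] at hm
    nlinarith
  have main : ∀ n : Fin k → ℕ, StrictMono n → (∀ i, Nat.pair k m ≤ n i) →
      ∀ b ∈ A k m, |‖∑ i, b i • x (φ (n i))‖ - c k b| < 1 / ((m : ℝ) + 1) := by
    intro n hn hN b hb
    -- The type of `b` depends on the decoded length, so the pair is generalized to a variable
    -- rather than rewritten.
    have h1 : ∀ (q : ℕ × ℕ) (j : ℕ), j.unpair = q → ∀ I : Finset ℕ, I.card = q.1 →
        (∀ i ∈ I, j ≤ i) → ∀ b ∈ A q.1 q.2,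
          |combNorm x b (I.image φ) - c q.1 b| < 1 / ((q.2 : ℝ) + 1) := by
      rintro _ j rfl
      exact hP j
    have h2 := h1 (k, m) _ (Nat.unpair_pair k m) (Finset.univ.image n) (by
      rw [Finset.card_image_of_injective _ hn.injective, Finset.card_univ, Fintype.card_fin])
      (by simpa using hN) b hb
    rw [Finset.image_image, combNorm_image x b (hφ.comp hn)] at h2
    exact h2
  refine ⟨Nat.pair k m, fun n n' hn hn' hN hN' a ha => ?_⟩
  obtain ⟨b, hb, hab⟩ := hA k m a ha
  have hdiff : ∀ n : Fin k → ℕ,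
      |‖∑ i, a i • x (φ (n i))‖ - ‖∑ i, b i • x (φ (n i))‖| ≤ k * M * (1 / ((m : ℝ) + 1)) := by
    intro n
    refine (abs_norm_sub_norm_le _ _).trans ?_
    rw [← Finset.sum_sub_distrib]
    simp only [← sub_smul]
    refine (norm_sum_smul_le _ (fun i _ => hM _) fun i => a i - b i).trans ?_
    have : ∑ i, |a i - b i| ≤ k * (1 / ((m : ℝ) + 1)) := by
      refine (Finset.sum_le_sum fun i _ => hab i).trans ?_
      simp
    nlinarith
  have h1 := abs_le.1 (hdiff n)
  have h2 := abs_le.1 (hdiff n')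
  have h3 := abs_lt.1 (main n hn hN b hb)
  have h4 := abs_lt.1 (main n' hn' hN' b hb)
  rw [abs_le]
  constructor <;> nlinarith [h1.1, h1.2, h2.1, h2.2, h3.1, h3.2, h4.1, h4.2]

/-- A seminormalized sequence with bounded initial-segment projections has a subsequence with a
spreading model; the norms in the spreading model are limits along an ultrafilter. -/
theorem exists_spreadingModel {x : ℕ → E} {M C c : ℝ} (hM : ∀ n, ‖x n‖ ≤ M) (hc : 0 < c)
    (hx : ∀ n, c ≤ ‖x n‖) (hC : PrefixBound x C) :
    ∃ (φ : ℕ → ℕ) (_ : StrictMono φ) (S : Type) (_ : NormedAddCommGroup S)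
      (_ : NormedSpace ℝ S) (_ : CompleteSpace S) (e : ℕ → S), IsSpreadingModel (x ∘ φ) e ∧
      ∀ (a : ℕ → ℝ) (m : ℕ), Tendsto (fun N => ‖∑ i ∈ Finset.range m, a i • x (φ (N + i))‖)
        (hyperfilter ℕ : Filter ℕ) (𝓝 ‖∑ i ∈ Finset.range m, a i • e i‖) := by
  classical
  obtain ⟨φ, hφ, hspr⟩ := exists_strictMono_asymptotically_spreading hM
  -- The ultralimit of the norms of shifted combinations is a seminorm on finitely supported
  -- coefficients; its completion carries the spreading model.
  let y : ℕ → (ℕ →₀ ℝ) →ₗ[ℝ] E := fun N => Finsupp.linearCombination ℝ fun i => x (φ (N + i))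
  have hlim : ∀ l : ℕ →₀ ℝ, ∃ d : ℝ,
      Tendsto (fun N => ‖y N l‖) (hyperfilter ℕ : Filter ℕ) (𝓝 d) := by
    intro l
    obtain ⟨d, -, hd⟩ := (isCompact_Icc (a := 0) (b := (∑ i ∈ l.support, |l i|) * M)).ultrafilter_le_nhds
      ((hyperfilter ℕ).map fun N => ‖y N l‖) (by
        rw [le_principal_iff]
        refine Eventually.of_forall (f := (hyperfilter ℕ : Filter ℕ)) fun N => ⟨norm_nonneg _, ?_⟩
        exact norm_sum_smul_le _ (fun i _ => hM _) _)
    exact ⟨d, hd⟩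
  choose L hL using hlim
  let p : Seminorm ℝ (ℕ →₀ ℝ) := Seminorm.of L
    (fun a b => le_of_tendsto_of_tendsto' (hL (a + b)) ((hL a).add (hL b)) fun N => by
      rw [map_add]; exact norm_add_le _ _)
    (fun t a => tendsto_nhds_unique (hL (t • a)) (((hL a).const_mul ‖t‖).congr fun N => by
      rw [map_smul, norm_smul]))
  obtain ⟨S, i1, i2, i3, T, hT⟩ := p.exists_banach_linearMap_norm_eq
  let e : ℕ → S := fun i => T (Finsupp.single i 1)
  have hsum : ∀ {ι : Type} (I : Finset ι) (a : ι → ℝ) (n : ι → ℕ),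
      Tendsto (fun N => ‖∑ i ∈ I, a i • x (φ (N + n i))‖)
        (hyperfilter ℕ : Filter ℕ) (𝓝 ‖∑ i ∈ I, a i • e (n i)‖) := by
    intro ι I a n
    have h1 : ∑ i ∈ I, a i • e (n i) = T (∑ i ∈ I, a i • Finsupp.single (n i) 1) := by
      simp only [e, map_sum, map_smul]
    rw [h1, hT]
    refine (hL _).congr fun N => ?_
    simp only [map_sum, map_smul, y, Finsupp.linearCombination_single, one_smul]
  have hlow : ∀ n, c ≤ ‖e n‖ := by
    intro n
    have := hsum (Finset.univ : Finset Unit) (fun _ => 1) (fun _ => n)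
    simp only [Finset.univ_unique, Finset.sum_singleton, one_smul] at this
    exact ge_of_tendsto' this fun N => hx _
  have hpre : PrefixBound e C := fun a m N hmN =>
    le_of_tendsto_of_tendsto' (hsum (Finset.range m) a id)
      ((hsum (Finset.range N) a id).const_mul C) fun K =>
        (hC.comp (φ := fun i => φ (K + i)) (hφ.comp fun i j hij => by simpa using hij)) a m N hmN
  refine ⟨φ, hφ, S, i1, i2, i3, e, ⟨?_, ?_, ?_, ?_⟩, fun a m => hsum _ a id⟩
  · exact (hC.comp hφ).isBasicSequence fun n => norm_pos_iff.1 (hc.trans_le (hx _))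
  · exact ⟨c, M, hc, fun n => ⟨hx _, hM _⟩⟩
  · exact hpre.isBasicSequence fun n => norm_pos_iff.1 (hc.trans_le (hlow n))
  -- Late choices of indices have nearly equal norms, so the given one can be compared with the
  -- shifts `K + i` and `K` sent to the limit.
  · intro k ε hε
    obtain ⟨N, hN⟩ := hspr k (ε / 2) (half_pos hε)
    refine ⟨N, fun n hn hNn a ha => lt_of_le_of_lt ?_ (half_lt_self hε)⟩
    have hlim := (hsum (Finset.univ : Finset (Fin k)) a fun i => (i : ℕ)).const_sub
      ‖∑ i, a i • (x ∘ φ) (n i)‖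
    refine le_of_tendsto hlim.abs ?_
    filter_upwards [Nat.hyperfilter_le_atTop (eventually_ge_atTop N)] with K hK
    exact hN n (fun i => K + i) hn (fun i j hij => by simpa using hij) (fun i => (hNn i).le)
      (fun i => by omega) a ha

end Spreading

/-! ### Functions outside `B_{1/2}(K)` -/

section BaireHalf

set_option linter.unusedSectionVars false

variable {K : Type*} [MetricSpace K] [CompactSpace K]

theorem VariationBound.of_sum_range_le {F : K → ℝ} {C : ℝ} (hC : 0 ≤ C) (f : ℕ → C(K, ℝ))
    (h0 : f 0 = 0) (hf : ∀ k, Tendsto (fun n => f n k) atTop (𝓝 (F k)))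
    (hb : ∀ k N, ∑ n ∈ Finset.range N, |f (n + 1) k - f n k| ≤ C) : VariationBound F C :=
  ⟨hC, f, h0, hf, fun k => ⟨summable_of_sum_range_le (fun _ => abs_nonneg _) (hb k),
    Real.tsum_le_of_sum_range_le (fun _ => abs_nonneg _) (hb k)⟩⟩

theorem DBSC.of_continuous (f : C(K, ℝ)) : DBSC ⇑f := by
  refine ⟨‖f‖, VariationBound.of_sum_range_le (norm_nonneg _) (fun n => if n = 0 then 0 else f)
    (by simp) (fun k => ?_) fun k N => ?_⟩
  · refine tendsto_const_nhds.congr' ?_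
    filter_upwards [eventually_gt_atTop 0] with n hn
    rw [if_neg hn.ne']
  · have : ∀ n : ℕ, |(if n + 1 = 0 then (0 : C(K, ℝ)) else f) k -
        (if n = 0 then (0 : C(K, ℝ)) else f) k| = if n = 0 then |f k| else 0 := by
      intro n
      by_cases hn : n = 0 <;> simp [hn]
    simp only [this, Finset.sum_ite_eq']
    split_ifs
    · exact f.norm_coe_le_norm k
    · exact norm_nonneg _

theorem DBSC.add {F G : K → ℝ} (hF : DBSC F) (hG : DBSC G) : DBSC (fun k => F k + G k) := by
  obtain ⟨C, hC, f, f0, hf, hfs⟩ := hF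
  obtain ⟨D, hD, g, g0, hg, hgs⟩ := hG
  refine ⟨C + D, VariationBound.of_sum_range_le (add_nonneg hC hD) (fun n => f n + g n)
    (by simp [f0, g0]) (fun k => (hf k).add (hg k)) fun k N => ?_⟩
  have h1 := ((hfs k).1.sum_le_tsum (Finset.range N) fun _ _ => abs_nonneg _).trans (hfs k).2
  have h2 := ((hgs k).1.sum_le_tsum (Finset.range N) fun _ _ => abs_nonneg _).trans (hgs k).2
  refine le_trans ?_ (add_le_add h1 h2)
  rw [← Finset.sum_add_distrib]
  refine Finset.sum_le_sum fun n _ => ?_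
  rw [ContinuousMap.add_apply, ContinuousMap.add_apply, add_sub_add_comm]
  exact abs_add_le _ _

theorem DBSC.const_mul {F : K → ℝ} (hF : DBSC F) (c : ℝ) : DBSC (fun k => c * F k) := by
  obtain ⟨C, hC, f, f0, hf, hfs⟩ := hF
  refine ⟨|c| * C, VariationBound.of_sum_range_le (by positivity) (fun n => c • f n)
    (by simp [f0]) (fun k => (hf k).const_mul c) fun k N => ?_⟩
  have h1 := ((hfs k).1.sum_le_tsum (Finset.range N) fun _ _ => abs_nonneg _).trans (hfs k).2
  refine le_trans (le_of_eq ?_) (mul_le_mul_of_nonneg_left h1 (abs_nonneg c))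
  rw [Finset.mul_sum]
  refine Finset.sum_congr rfl fun n _ => ?_
  rw [ContinuousMap.smul_apply, ContinuousMap.smul_apply, ← smul_sub, smul_eq_mul, abs_mul]

theorem DBSC.sum {ι : Type*} (I : Finset ι) {F : ι → K → ℝ} (hF : ∀ i ∈ I, DBSC (F i)) :
    DBSC (fun k => ∑ i ∈ I, F i k) := by
  classical
  induction I using Finset.induction_on with
  | empty => simpa using! DBSC.of_continuous (0 : C(K, ℝ))
  | insert i I hi ih =>
    simp only [Finset.sum_insert hi]
    exact (hF i (Finset.mem_insert_self _ _)).add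
      (ih fun j hj => hF j (Finset.mem_insert_of_mem hj))

theorem DBSC.indicator_of_isClosed {A : Set K} (hA : IsClosed A) :
    DBSC (A.indicator fun _ => (1 : ℝ)) := by
  have hpos : ∀ n : ℕ, 0 < 1 / ((n : ℝ) + 1) := fun n => by positivity
  let g : ℕ → C(K, ℝ) := fun n =>
    ⟨fun k => ((thickenedIndicator (hpos n) A k : NNReal) : ℝ), by fun_prop⟩
  have hg0 : ∀ n k, 0 ≤ g n k := fun n k => NNReal.coe_nonneg _
  have hg1 : ∀ n k, g n k ≤ 1 := fun n k =>
    NNReal.coe_le_one.2 (thickenedIndicator_le_one (hpos n) A k)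
  have hanti : ∀ n k, g (n + 1) k ≤ g n k := fun n k => by
    refine NNReal.coe_le_coe.2 (thickenedIndicator_mono (hpos (n + 1)) (hpos n) ?_ A k)
    push_cast
    gcongr
    linarith
  -- The jump from `0` to `g 0` contributes at most `1`, and the decreasing sequence `g` telescopes
  -- to at most `1`.
  refine ⟨2, VariationBound.of_sum_range_le zero_le_two (fun n => Nat.casesOn n 0 g) rfl
    (fun k => ?_) fun k N => ?_⟩
  · rw [← tendsto_add_atTop_iff_nat 1]
    have h1 := tendsto_pi_nhds.1 (thickenedIndicator_tendsto_indicator_closure hpos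
      tendsto_one_div_add_atTop_nhds_zero_nat A) k
    rw [hA.closure_eq] at h1
    have h2 := (NNReal.continuous_coe.tendsto _).comp h1
    refine (h2.congr fun n => rfl).trans (le_of_eq ?_)
    by_cases hk : k ∈ A <;> simp [hk]
  · have key : ∀ N, ∑ n ∈ Finset.range N, |g (n + 1) k - g n k| = g 0 k - g N k := by
      intro N
      induction N with
      | zero => simp
      | succ N ih =>
        rw [Finset.sum_range_succ, ih, abs_sub_comm, abs_of_nonneg (sub_nonneg.2 (hanti N k))]
        ring
    cases N with
    | zero => simp
    | succ N =>
      rw [Finset.sum_range_succ']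
      have h3 : |g 0 k - (0 : C(K, ℝ)) k| = g 0 k := by
        rw [ContinuousMap.zero_apply, sub_zero, abs_of_nonneg (hg0 0 k)]
      have := key N
      change ∑ n ∈ Finset.range N, |g (n + 1) k - g n k| + |g 0 k - (0 : C(K, ℝ)) k| ≤ 2
      rw [this, h3]
      linarith [hg0 N k, hg1 0 k]

/-- The finite derivation process attached to `F` and the levels `a < b`: the next set consists of
the points that are limits both of points with `F ≤ a` and of points with `b ≤ F`. -/
def oscDerived (F : K → ℝ) (a b : ℝ) : ℕ → Set K
  | 0 => Set.univ
  | n + 1 => closure (oscDerived F a b n ∩ {x | F x ≤ a}) ∩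
      closure (oscDerived F a b n ∩ {x | b ≤ F x})

theorem isClosed_oscDerived (F : K → ℝ) (a b : ℝ) : ∀ n, IsClosed (oscDerived F a b n)
  | 0 => isClosed_univ
  | _ + 1 => isClosed_closure.inter isClosed_closure

theorem closure_oscDerived_inter_subset (F : K → ℝ) (a b : ℝ) (n : ℕ) (s : Set K) :
    closure (oscDerived F a b n ∩ s) ⊆ oscDerived F a b n :=
  closure_minimal Set.inter_subset_left (isClosed_oscDerived F a b n)

theorem oscDerived_antitone (F : K → ℝ) (a b : ℝ) : Antitone (oscDerived F a b) :=
  antitone_nat_of_succ_le fun n =>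
    Set.inter_subset_left.trans (closure_oscDerived_inter_subset F a b n _)

/-- The closed sets satisfy `D 0 ⊇ A 0 ⊇ D 1 ⊇ A 1 ⊇ …` with `A j` the closure of `D j ∩ {F ≤ a}`.
The alternating sum of their indicators is therefore `1 - 1_{A j}` on `D j \ D (j + 1)`, where no
point of `A j` can satisfy `b ≤ F`. -/
theorem exists_DBSC_separating {F : K → ℝ} {a b : ℝ} {N : ℕ} (hN : oscDerived F a b N = ∅) :
    ∃ H : K → ℝ, DBSC H ∧ ∀ x, 0 ≤ H x ∧ H x ≤ 1 ∧ (F x ≤ a → H x = 0) ∧ (b ≤ F x → H x = 1) := by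
  classical
  set D := oscDerived F a b with hD
  let A : ℕ → Set K := fun j => closure (D j ∩ {x | F x ≤ a})
  refine ⟨fun x => ∑ j ∈ Finset.range N, ((D j).indicator (fun _ => (1 : ℝ)) x +
    (-1) * (A j).indicator (fun _ => (1 : ℝ)) x), DBSC.sum _ fun j _ => ?_, fun x => ?_⟩
  · exact (DBSC.indicator_of_isClosed (isClosed_oscDerived F a b j)).add
      ((DBSC.indicator_of_isClosed isClosed_closure).const_mul _)
  · have hex : ∃ j, x ∉ D j := ⟨N, by rw [hN]; exact Set.notMem_empty x⟩
    obtain ⟨j, hj⟩ : ∃ j, Nat.find hex = j + 1 := by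
      refine Nat.exists_eq_succ_of_ne_zero fun h0 => ?_
      have := Nat.find_spec hex
      rw [h0] at this
      exact this (Set.mem_univ x)
    have hjN : j < N := by
      have : Nat.find hex ≤ N := Nat.find_min' hex (by rw [hN]; exact Set.notMem_empty x)
      omega
    have hxj : x ∈ D j := not_not.1 (Nat.find_min hex (by omega))
    have hxj' : x ∉ D (j + 1) := hj ▸ Nat.find_spec hex
    have hsum : ∑ i ∈ Finset.range N, ((D i).indicator (fun _ => (1 : ℝ)) x +
        (-1) * (A i).indicator (fun _ => (1 : ℝ)) x) =
        1 + (-1) * (A j).indicator (fun _ => (1 : ℝ)) x := by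
      rw [Finset.sum_eq_single_of_mem j (Finset.mem_range.2 hjN),
        Set.indicator_of_mem hxj]
      intro i _ hij
      rcases lt_or_gt_of_ne hij with h | h
      · have hi : x ∈ D (i + 1) := oscDerived_antitone F a b (Nat.succ_le_of_lt h) hxj
        rw [Set.indicator_of_mem (show x ∈ D i from oscDerived_antitone F a b (Nat.le_succ i) hi),
          Set.indicator_of_mem (show x ∈ A i from hi.1)]
        ring
      · have hi : x ∉ D i := fun hmem =>
          hxj' (oscDerived_antitone F a b (Nat.succ_le_of_lt h) hmem)
        rw [Set.indicator_of_notMem hi, Set.indicator_of_notMem (show x ∉ A i from fun hmem =>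
          hi (closure_oscDerived_inter_subset F a b i _ hmem))]
        ring
    beta_reduce
    rw [hsum]
    by_cases hA : x ∈ A j
    · rw [Set.indicator_of_mem hA]
      refine ⟨by norm_num, by norm_num, fun _ => by norm_num, fun hb => ?_⟩
      exact (hxj' ⟨hA, subset_closure ⟨hxj, hb⟩⟩).elim
    · rw [Set.indicator_of_notMem hA]
      refine ⟨by norm_num, by norm_num, fun ha => ?_, fun _ => by norm_num⟩
      exact (hA (subset_closure ⟨hxj, ha⟩)).elim

theorem BaireOne.exists_abs_le {F : K → ℝ} (hF : BaireOne F) : ∃ M : ℝ, 0 ≤ M ∧ ∀ k, |F k| ≤ M := by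
  obtain ⟨f, ⟨M, hM⟩, hf⟩ := hF
  exact ⟨max M 0, le_max_right _ _, fun k =>
    le_of_tendsto' (hf k).abs fun n => (hM n k).trans (le_max_left _ _)⟩

/-- The range is cut into slices of height `ε`, with a separating function `H i` for each. If `F k`
lies in slice `l`, then `H i k` is `1` for `i < l` and `0` for `i > l`, so only the slice `l` itself
contributes an error. -/
theorem exists_DBSC_abs_sub_le {F : K → ℝ} {M : ℝ} (hM : ∀ k, |F k| ≤ M)
    (hF : ∀ a b, a < b → ∃ n, oscDerived F a b n = ∅) {ε : ℝ} (hε : 0 < ε) :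
    ∃ G : K → ℝ, DBSC G ∧ ∀ k, |F k - G k| ≤ ε := by
  choose H hH hsep using fun i : ℕ =>
    exists_DBSC_separating (hF (-M + i * ε) (-M + (i + 1) * ε) (by nlinarith)).choose_spec
  obtain ⟨p, hp⟩ := exists_nat_gt ((2 * M) / ε)
  rw [div_lt_iff₀ hε] at hp
  refine ⟨fun k => -M + ε * ∑ i ∈ Finset.range p, H i k,
    (DBSC.of_continuous (ContinuousMap.const K (-M))).add ((DBSC.sum _ fun i _ => hH i).const_mul ε),
    fun k => ?_⟩
  have hk := abs_le.1 (hM k)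
  have ht0 : 0 ≤ (F k + M) / ε := div_nonneg (by linarith) hε.le
  obtain ⟨l, hl1, hl2⟩ : ∃ l : ℕ, (l : ℝ) * ε ≤ F k + M ∧ F k + M < (l + 1) * ε :=
    ⟨⌊(F k + M) / ε⌋₊, by rw [← le_div_iff₀ hε]; exact Nat.floor_le ht0,
      by rw [← div_lt_iff₀ hε]; exact Nat.lt_floor_add_one _⟩
  have hlp : l ≤ p := by
    have : (l : ℝ) * ε < p * ε := by linarith
    have := lt_of_mul_lt_mul_right this hε.le
    exact_mod_cast this.le
  have hlow : (l : ℝ) ≤ ∑ i ∈ Finset.range p, H i k := by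
    calc (l : ℝ) = ∑ i ∈ Finset.range l, H i k := by
          rw [Finset.sum_congr rfl fun i hi => (hsep i k).2.2.2 ?_]
          · simp
          · have : (i : ℝ) + 1 ≤ l := by exact_mod_cast Finset.mem_range.1 hi
            nlinarith
      _ ≤ _ := Finset.sum_le_sum_of_subset_of_nonneg (Finset.range_mono hlp)
          fun i _ _ => (hsep i k).1
  have hup : ∑ i ∈ Finset.range p, H i k ≤ l + 1 := by
    calc ∑ i ∈ Finset.range p, H i k
        ≤ ∑ i ∈ Finset.range p, if i < l + 1 then (1 : ℝ) else 0 := by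
          refine Finset.sum_le_sum fun i _ => ?_
          split_ifs with hi
          · exact (hsep i k).2.1
          · refine ((hsep i k).2.2.1 ?_).le
            have : (l : ℝ) + 1 ≤ i := by exact_mod_cast not_lt.1 hi
            nlinarith
      _ = (((Finset.range p).filter (· < l + 1)).card : ℝ) := by
          rw [Finset.sum_boole]
      _ ≤ ((Finset.range (l + 1)).card : ℝ) := by
          refine Nat.cast_le.2 (Finset.card_le_card fun i hi => ?_)
          exact Finset.mem_range.2 (Finset.mem_filter.1 hi).2
      _ = l + 1 := by simp
  rw [abs_le]
  constructor <;> nlinarith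

theorem BaireOne.exists_oscDerived_nonempty {F : K → ℝ} (hF : BaireOne F) (hF' : ¬ BaireHalf F) :
    ∃ a b, a < b ∧ ∀ n, (oscDerived F a b n).Nonempty := by
  by_contra! hcon
  obtain ⟨M, -, hM⟩ := hF.exists_abs_le
  refine hF' ⟨hF, ?_⟩
  choose G hG hGF using fun n : ℕ =>
    exists_DBSC_abs_sub_le hM hcon (ε := 1 / ((n : ℝ) + 1)) (by positivity)
  refine ⟨G, hG, Metric.tendstoUniformly_iff.2 fun ε hε => ?_⟩
  filter_upwards [tendsto_one_div_add_atTop_nhds_zero_nat.eventually (gt_mem_nhds hε)] with n hn k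
  exact (hGF n k).trans_lt hn

/-- At some point, the functions `f i` with `i ∈ s ∩ c` are above `b` and those with `i ∈ s \ c`
are below `a`, for every choice of `c`. -/
def IndependentAt (f : ℕ → C(K, ℝ)) (a b : ℝ) (s : Finset ℕ) : Prop :=
  ∀ c : Finset ℕ, ∃ p, ∀ i ∈ s, (i ∈ c → b < f i p) ∧ (i ∉ c → f i p < a)

/-- A point of the derived set of order `r + 1` is a limit of points `v`, `w` of order `r` with `F v
≤ a` and `b ≤ F w`. The strict inequalities at the indices in `s` are open conditions, so they
persist at `v` and `w`, and pointwise convergence places a late new `f n` on the required side. -/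
theorem iterEventually_independentAt {F : K → ℝ} {a b a' b' : ℝ} (ha : a < a') (hb : b' < b)
    {f : ℕ → C(K, ℝ)} (hf : ∀ k, Tendsto (fun n => f n k) atTop (𝓝 (F k))) (r : ℕ) (s : Finset ℕ)
    (hs : ∀ c : Finset ℕ, ∃ p ∈ oscDerived F a b r,
      ∀ i ∈ s, (i ∈ c → b' < f i p) ∧ (i ∉ c → f i p < a')) :
    IterEventually atTop (IndependentAt f a' b') r s := by
  classical
  induction r generalizing s with
  | zero =>
    intro c
    obtain ⟨p, -, hp⟩ := hs c
    exact ⟨p, hp⟩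
  | succ r ih =>
    have hopen : ∀ c : Finset ℕ,
        IsOpen {p | ∀ i ∈ s, (i ∈ c → b' < f i p) ∧ (i ∉ c → f i p < a')} := by
      intro c
      simp only [Set.ofPred_forall]
      refine isOpen_biInter_finset fun i _ => ?_
      by_cases hi : i ∈ c
      · simpa [hi] using isOpen_lt continuous_const (f i).continuous
      · simpa [hi] using isOpen_lt (f i).continuous continuous_const
    have hpts : ∀ c : Finset ℕ, ∃ v w, (v ∈ oscDerived F a b r ∧ F v ≤ a ∧
        ∀ i ∈ s, (i ∈ c → b' < f i v) ∧ (i ∉ c → f i v < a')) ∧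
        (w ∈ oscDerived F a b r ∧ b ≤ F w ∧
        ∀ i ∈ s, (i ∈ c → b' < f i w) ∧ (i ∉ c → f i w < a')) := by
      intro c
      obtain ⟨p, ⟨hp1, hp2⟩, hp⟩ := hs c
      obtain ⟨v, hv, hv1, hv2⟩ := mem_closure_iff.1 hp1 _ (hopen c) hp
      obtain ⟨w, hw, hw1, hw2⟩ := mem_closure_iff.1 hp2 _ (hopen c) hp
      exact ⟨v, w, ⟨hv1, hv2, hv⟩, hw1, hw2, hw⟩
    choose v w hv hw using hpts
    -- Only the trace of `c` on `s` matters, so finitely many points have to be handled.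
    have hev : ∀ᶠ n in atTop, n ∉ s ∧ ∀ c ∈ s.powerset, f n (v c) < a' ∧ b' < f n (w c) := by
      refine Eventually.and ?_ ?_
      · exact Nat.cofinite_eq_atTop ▸ s.finite_toSet.eventually_cofinite_notMem
      · rw [Finset.eventually_all]
        exact fun c _ => ((hf (v c)).eventually_lt_const ((hv c).2.1.trans_lt ha)).and
          ((hf (w c)).eventually_const_lt (hb.trans_le (hw c).2.1))
    refine hev.mono fun n hn => ih _ fun c => ?_
    have hcs : s ∩ c ∈ s.powerset := Finset.mem_powerset.2 Finset.inter_subset_left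
    by_cases hnc : n ∈ c
    · refine ⟨w (s ∩ c), (hw _).1, fun i hi => ?_⟩
      rcases Finset.mem_insert.1 hi with rfl | hi
      · exact ⟨fun _ => (hn.2 _ hcs).2, fun h => absurd hnc h⟩
      · simpa [hi] using (hw (s ∩ c)).2.2 i hi
    · refine ⟨v (s ∩ c), (hv _).1, fun i hi => ?_⟩
      rcases Finset.mem_insert.1 hi with rfl | hi
      · exact ⟨fun h => absurd h hnc, fun _ => (hn.2 _ hcs).1⟩
      · simpa [hi] using (hv (s ∩ c)).2.2 i hi

/-- Independence gives `p` where the functions with nonnegative coefficients are high and the others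
low, and `q` with the opposite pattern. The values at `p` and `q` differ by at least `(b - a) * ∑ |t
i|`, and the difference is at most twice the norm. -/
theorem IndependentAt.sum_abs_le {f : ℕ → C(K, ℝ)} {a b : ℝ} {n : ℕ → ℕ} {m : ℕ}
    (hn : StrictMono n) (h : IndependentAt f a b ((Finset.range m).image n)) (t : ℕ → ℝ) :
    (b - a) / 2 * ∑ i ∈ Finset.range m, |t i| ≤ ‖∑ i ∈ Finset.range m, t i • f (n i)‖ := by
  classical
  obtain ⟨p, hp⟩ := h (((Finset.range m).filter fun i => 0 ≤ t i).image n)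
  obtain ⟨q, hq⟩ := h (((Finset.range m).filter fun i => t i < 0).image n)
  set y := ∑ i ∈ Finset.range m, t i • f (n i) with hy
  have hval : ∀ z, y z = ∑ i ∈ Finset.range m, t i * f (n i) z := fun z => by
    rw [hy, ContinuousMap.sum_apply]
    rfl
  have h1 : (b - a) * ∑ i ∈ Finset.range m, |t i| ≤ y p - y q := by
    rw [hval, hval, ← Finset.sum_sub_distrib, Finset.mul_sum]
    refine Finset.sum_le_sum fun i hi => ?_
    have hpi := hp (n i) (Finset.mem_image_of_mem _ hi)
    have hqi := hq (n i) (Finset.mem_image_of_mem _ hi)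
    simp only [Finset.mem_image, Finset.mem_filter, hn.injective.eq_iff, exists_eq_right] at hpi hqi
    rw [← mul_sub]
    rcases le_or_gt 0 (t i) with h0 | h0
    · have h2 := hpi.1 ⟨hi, h0⟩
      have h3 := hqi.2 fun hh => absurd hh.2 (not_lt.2 h0)
      rw [abs_of_nonneg h0]
      nlinarith
    · have h2 := hpi.2 fun hh => absurd hh.2 (not_le.2 h0)
      have h3 := hqi.1 ⟨hi, h0⟩
      rw [abs_of_neg h0]
      nlinarith
  have h2 := abs_le.1 (y.norm_coe_le_norm p)
  have h3 := abs_le.1 (y.norm_coe_le_norm q)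
  linarith [h2.2, h3.1]

/-- A sequence of continuous functions converging pointwise to a function outside `B_{1/2}(K)` has
a subsequence all of whose sufficiently late finite pieces are uniformly equivalent to the unit
vector basis of `ℓ₁`. -/
theorem exists_strictMono_late_ellOne {F : K → ℝ} (hF : BaireOne F) (hF' : ¬ BaireHalf F)
    {f : ℕ → C(K, ℝ)} (hf : ∀ k, Tendsto (fun n => f n k) atTop (𝓝 (F k))) :
    ∃ φ : ℕ → ℕ, StrictMono φ ∧ ∃ δ > 0, ∀ (m : ℕ) (n : ℕ → ℕ), StrictMono n → m ≤ n 0 →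
      ∀ t : ℕ → ℝ, δ * ∑ i ∈ Finset.range m, |t i| ≤
        ‖∑ i ∈ Finset.range m, t i • f (φ (n i))‖ := by
  classical
  obtain ⟨a, b, hab, hne⟩ := hF.exists_oscDerived_nonempty hF'
  obtain ⟨a', ha, ha'⟩ := exists_between hab
  obtain ⟨b', hb', hb⟩ := exists_between ha'
  obtain ⟨φ, hφ, h⟩ := exists_strictMono_forall_of_iterEventually (u := atTop) le_rfl
    (fun _ => IndependentAt f a' b') (fun j => j) fun j =>
      iterEventually_independentAt ha hb hf j ∅ fun c => by
        obtain ⟨p, hp⟩ := hne j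
        exact ⟨p, hp, by simp⟩
  refine ⟨φ, hφ, (b' - a') / 2, by linarith, fun m n hn hmn t => ?_⟩
  refine IndependentAt.sum_abs_le (hφ.comp hn) ?_ t
  have := h m ((Finset.range m).image n)
    (by rw [Finset.card_image_of_injective _ hn.injective, Finset.card_range])
    (fun i hi => by
      obtain ⟨l, -, rfl⟩ := Finset.mem_image.1 hi
      exact hmn.trans (hn.monotone (Nat.zero_le l)))
  rwa [Finset.image_image] at this

end BaireHalf

/-! ### Convex combinations of tails -/

section ConvexBlocks

/-- `w` is a finite system of convex weights supported in `[N, ∞)`. -/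
def IsTailWeight (N : ℕ) (w : ℕ →₀ ℝ) : Prop :=
  (∀ i, 0 ≤ w i) ∧ w.linearCombination ℝ (fun _ => (1 : ℝ)) = 1 ∧ ∀ i < N, w i = 0

theorem isTailWeight_single {N n : ℕ} (h : N ≤ n) : IsTailWeight N (Finsupp.single n 1) := by
  classical
  refine ⟨fun i => ?_, by simp, fun i hi => ?_⟩
  · rw [Finsupp.single_apply]; split_ifs <;> norm_num
  · rw [Finsupp.single_apply, if_neg]; omega

theorem convex_isTailWeight (N : ℕ) : Convex ℝ {w | IsTailWeight N w} := by
  rintro w ⟨hw0, hw1, hw⟩ v ⟨hv0, hv1, hv⟩ a b ha hb hab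
  refine ⟨fun i => ?_, ?_, fun i hi => ?_⟩
  · simpa using add_nonneg (mul_nonneg ha (hw0 i)) (mul_nonneg hb (hv0 i))
  · rw [map_add, map_smul, map_smul, hw1, hv1]; simpa using hab
  · simp [hw i hi, hv i hi]

theorem IsTailWeight.linearCombination_le {N : ℕ} {w : ℕ →₀ ℝ} (hw : IsTailWeight N w)
    {g : ℕ → ℝ} {B : ℝ} (hg : ∀ i, N ≤ i → w i ≠ 0 → g i ≤ B) : w.linearCombination ℝ g ≤ B := by
  have h1 : B = w.linearCombination ℝ (fun _ => (1 : ℝ)) * B := by rw [hw.2.1, one_mul]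
  rw [h1, Finsupp.linearCombination_apply, Finsupp.linearCombination_apply, Finsupp.sum,
    Finsupp.sum, Finset.sum_mul]
  refine Finset.sum_le_sum fun i hi => ?_
  have hi0 : w i ≠ 0 := Finsupp.mem_support_iff.1 hi
  have hiN : N ≤ i := by
    by_contra hlt
    exact hi0 (hw.2.2 i (not_le.1 hlt))
  simpa using mul_le_mul_of_nonneg_left (hg i hiN hi0) (hw.1 i)

theorem IsTailWeight.norm_linearCombination_le {E : Type*} [NormedAddCommGroup E]
    [NormedSpace ℝ E] {N : ℕ} {w : ℕ →₀ ℝ} (hw : IsTailWeight N w) (x : ℕ → E) :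
    ‖w.linearCombination ℝ x‖ ≤ w.linearCombination ℝ fun i => ‖x i‖ := by
  rw [Finsupp.linearCombination_apply, Finsupp.linearCombination_apply]
  refine norm_sum_le_of_le _ fun i _ => ?_
  rw [norm_smul, Real.norm_eq_abs, abs_of_nonneg (hw.1 i)]
  exact le_rfl

theorem IsTailWeight.linearCombination_sub_const {N : ℕ} {w : ℕ →₀ ℝ} (hw : IsTailWeight N w)
    (g : ℕ → ℝ) (c : ℝ) :
    w.linearCombination ℝ g - c = w.linearCombination ℝ fun i => g i - c := by
  have h1 : c = w.linearCombination ℝ fun _ => c := by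
    have := congrArg (· * c) hw.2.1
    simp only [Finsupp.linearCombination_apply, Finsupp.sum, smul_eq_mul, mul_one, one_mul,
      Finset.sum_mul] at this ⊢
    exact this.symm
  conv_lhs => rw [h1]
  simp only [Finsupp.linearCombination_apply, Finsupp.sum, smul_eq_mul, mul_sub,
    Finset.sum_sub_distrib]

theorem IsTailWeight.tendsto_linearCombination {N : ℕ → ℕ} (hN : Tendsto N atTop atTop)
    {w : ℕ → ℕ →₀ ℝ} (hw : ∀ n, IsTailWeight (N n) (w n)) {g : ℕ → ℝ} {c : ℝ}
    (hg : Tendsto g atTop (𝓝 c)) :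
    Tendsto (fun n => (w n).linearCombination ℝ g) atTop (𝓝 c) := by
  rw [Metric.tendsto_atTop]
  intro ε hε
  obtain ⟨m, hm⟩ := Metric.tendsto_atTop.1 hg (ε / 2) (half_pos hε)
  obtain ⟨n₀, hn₀⟩ := eventually_atTop.1 (hN.eventually_ge_atTop m)
  refine ⟨n₀, fun n hn => lt_of_le_of_lt ?_ (half_lt_self hε)⟩
  rw [Real.dist_eq, (hw n).linearCombination_sub_const]
  refine ((hw n).norm_linearCombination_le fun i => g i - c).trans ((hw n).linearCombination_le fun i hi _ => ?_)
  exact (hm i ((hn₀ n hn).trans hi)).le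

/-- If a sequence converges weak* to an element of the bidual of `Y`, then the convex
hulls of its tails come close to a fixed ball of `Y`. -/
theorem exists_norm_le_and_norm_sub_linearCombination_lt {E : Type*} [NormedAddCommGroup E]
    [NormedSpace ℝ E] {Y : Type*} [NormedAddCommGroup Y] [NormedSpace ℝ Y] (T : Y →L[ℝ] E)
    (ψ : StrongDual ℝ (StrongDual ℝ Y)) {f : ℕ → E}
    (hf : ∀ ℓ : StrongDual ℝ E,
      Tendsto (fun n => ℓ (f n)) atTop (𝓝 (ψ (ℓ.comp T)))) :
    ∃ M : ℝ, ∀ (N : ℕ) (η : ℝ), 0 < η → ∃ x : Y, ‖x‖ ≤ M ∧ ∃ w, IsTailWeight N w ∧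
      ‖T x - w.linearCombination ℝ f‖ < η := by
  -- The added `1` makes separation contradictory: with `r = ℓ.comp T` it yields `‖r‖ * (‖ψ‖ + 1) ≤
  -- v ≤ ψ r ≤ ‖ψ‖ * ‖r‖` with `v > 0`.
  set M := ‖ψ‖ + 1 with hMdef
  have hMpos : 0 < M := by positivity
  refine ⟨M, ?_⟩
  intro N η hη
  by_contra! hcon
  set B : Set E := T '' Metric.closedBall 0 M with hB
  have hBconv : Convex ℝ B := (convex_closedBall (0 : Y) M).linear_image T.toLinearMap
  obtain ⟨ℓ, v, hℓs, hℓt⟩ := geometric_hahn_banach_open (hBconv.thickening η)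
    Metric.isOpen_thickening
    ((convex_isTailWeight N).linear_image (Finsupp.linearCombination ℝ f)) (by
      rw [Set.disjoint_left]
      rintro _ hy ⟨w, hw, rfl⟩
      obtain ⟨_, ⟨x, hx, rfl⟩, hlt⟩ := Metric.mem_thickening_iff.1 hy
      refine absurd hlt (not_lt.2 ?_)
      rw [dist_comm, dist_eq_norm]
      exact hcon x (mem_closedBall_zero_iff.1 hx) w hw)
  have hsub : ∀ x : Y, ‖x‖ ≤ M → ℓ (T x) < v := fun x hx =>
    hℓs _ (Metric.self_subset_thickening hη _ ⟨x, mem_closedBall_zero_iff.2 hx, rfl⟩)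
  have hv : 0 < v := by simpa using hsub 0 (by simp [hMpos.le])
  set r := ℓ.comp T with hr
  have hrle : ‖r‖ ≤ v / M := by
    refine ContinuousLinearMap.opNorm_le_bound _ (by positivity) fun x => ?_
    by_cases hx : x = 0
    · simp [hx]
    have hxpos : 0 < ‖x‖ := norm_pos_iff.2 hx
    have hnorm : ‖(M / ‖x‖) • x‖ = M := by
      rw [norm_smul, Real.norm_of_nonneg (by positivity), div_mul_cancel₀ _ hxpos.ne']
    have h1 := hsub ((M / ‖x‖) • x) hnorm.le
    have h2 := hsub (-((M / ‖x‖) • x)) (by rw [norm_neg, hnorm])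
    have h3 : ℓ (T ((M / ‖x‖) • x)) = (M / ‖x‖) * r x := by
      rw [hr]
      simp
    rw [map_neg, map_neg, h3] at h2
    rw [h3] at h1
    have h4 : |(M / ‖x‖) * r x| ≤ v := abs_le.2 ⟨by linarith, h1.le⟩
    rw [abs_mul, abs_of_pos (by positivity), div_mul_eq_mul_div, div_le_iff₀ hxpos] at h4
    rw [Real.norm_eq_abs, div_mul_eq_mul_div, le_div_iff₀ hMpos]
    linarith
  have hle : v ≤ ψ r := by
    refine ge_of_tendsto (hf ℓ) ?_
    filter_upwards [eventually_ge_atTop N] with n hn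
    simpa using hℓt _ ⟨_, isTailWeight_single hn, rfl⟩
  have h5 : ψ r ≤ ‖ψ‖ * ‖r‖ := (le_abs_self _).trans (ψ.le_opNorm r)
  rw [le_div_iff₀ hMpos, hMdef] at hrle
  have h6 : ‖r‖ ≤ 0 := by linarith
  have h7 : ‖ψ‖ * ‖r‖ ≤ 0 := mul_nonpos_of_nonneg_of_nonpos ψ.opNorm_nonneg h6
  linarith

end ConvexBlocks

/-! ### Pointwise null sequences and Mazur-type approximation in `C(K)` -/

section PointwiseNull

open MeasureTheory

set_option linter.unusedSectionVars false

variable {K : Type*} [MetricSpace K] [CompactSpace K]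

theorem linearCombination_continuousMap_apply (f : ℕ → C(K, ℝ)) (w : ℕ →₀ ℝ) (k : K) :
    (w.linearCombination ℝ f) k = w.linearCombination ℝ fun i => f i k := by
  simp [Finsupp.linearCombination_apply, Finsupp.sum, ContinuousMap.sum_apply]

/-- By Riesz–Markov the functional is integration against a finite measure, so dominated convergence
applies. -/
theorem tendsto_zero_of_positive_functional (ℓ : StrongDual ℝ C(K, ℝ))
    (hℓ : ∀ g : C(K, ℝ), 0 ≤ g → 0 ≤ ℓ g) {q : ℕ → C(K, ℝ)} {M : ℝ} (hM : ∀ n k, |q n k| ≤ M)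
    (hq : ∀ k, Tendsto (fun n => q n k) atTop (𝓝 0)) :
    Tendsto (fun n => ℓ (q n)) atTop (𝓝 0) := by
  borelize K
  let Λ : CompactlySupportedContinuousMap K ℝ →ₚ[ℝ] ℝ := PositiveLinearMap.mk₀
    { toFun := fun g => ℓ g.toContinuousMap
      map_add' := fun g h => map_add ℓ g.toContinuousMap h.toContinuousMap
      map_smul' := fun c g => map_smul ℓ c g.toContinuousMap } fun g hg => hℓ _ hg
  have hint : ∀ n, ∫ x, q n x ∂(RealRMK.rieszMeasure Λ) = ℓ (q n) := fun n =>
    RealRMK.integral_rieszMeasure Λ (CompactlySupportedContinuousMap.continuousMapEquiv (q n))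
  simp only [← hint]
  rw [← integral_zero K ℝ (μ := RealRMK.rieszMeasure Λ)]
  exact tendsto_integral_of_dominated_convergence (fun _ => M)
    (fun n => (q n).continuous.aestronglyMeasurable) (integrable_const M)
    (fun n => Eventually.of_forall fun k => hM n k) (Eventually.of_forall hq)

/-- A bounded, pointwise null sequence of continuous functions has convex combinations of its
tails that are uniformly small. -/
theorem exists_isTailWeight_forall_lt {q : ℕ → C(K, ℝ)} {M : ℝ} (hM : ∀ n k, |q n k| ≤ M)
    (hq : ∀ k, Tendsto (fun n => q n k) atTop (𝓝 0)) (N : ℕ) {η : ℝ} (hη : 0 < η) :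
    ∃ w, IsTailWeight N w ∧ ∀ k, w.linearCombination ℝ (fun i => q i k) < η := by
  by_contra! hcon
  have hopen : IsOpen {g : C(K, ℝ) | Set.MapsTo g Set.univ (Set.Iio η)} :=
    ContinuousMap.isOpen_setOfPred_mapsTo isCompact_univ isOpen_Iio
  have hconv : Convex ℝ {g : C(K, ℝ) | Set.MapsTo g Set.univ (Set.Iio η)} := by
    intro g hg h hh a b ha hb hab k hk
    exact (convex_Iio η) (hg hk) (hh hk) ha hb hab
  obtain ⟨ℓ, v, hℓs, hℓt⟩ := geometric_hahn_banach_open hconv hopen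
    ((convex_isTailWeight N).linear_image (Finsupp.linearCombination ℝ q)) (by
      rw [Set.disjoint_left]
      rintro _ hg ⟨w, hw, rfl⟩
      obtain ⟨k, hk⟩ := hcon w hw
      have := hg (Set.mem_univ k)
      rw [linearCombination_continuousMap_apply] at this
      exact absurd this (not_lt.2 hk))
  have hv : 0 < v := by
    have := hℓs 0 fun k _ => by simpa using hη
    simpa using this
  -- The separated open set is one-sided and contains every nonpositive function; this forces `ℓ` to
  -- be positive, so no decomposition of signed measures is needed.
  have hpos : ∀ g : C(K, ℝ), 0 ≤ g → 0 ≤ ℓ g := by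
    intro g hg
    by_contra! hneg
    have h1 := hℓs ((v / ℓ g) • g) fun k _ => by
      have h2 : (v / ℓ g) * g k ≤ 0 :=
        mul_nonpos_of_nonpos_of_nonneg (div_nonpos_of_nonneg_of_nonpos hv.le hneg.le) (hg k)
      simpa using h2.trans_lt hη
    rw [map_smul, smul_eq_mul, div_mul_cancel₀ _ hneg.ne] at h1
    exact lt_irrefl _ h1
  have hlim := tendsto_zero_of_positive_functional ℓ hpos hM hq
  have : v ≤ 0 := by
    refine ge_of_tendsto hlim ?_
    filter_upwards [eventually_ge_atTop N] with n hn
    have := hℓt _ ⟨_, isTailWeight_single hn, rfl⟩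
    simpa using this
  linarith

/-- An element of a closed subspace: a continuous pointwise limit of a bounded sequence from it. -/
theorem mem_of_tendsto_pointwise {X : Submodule ℝ C(K, ℝ)} (hX : IsClosed (X : Set C(K, ℝ)))
    {x : ℕ → X} {M : ℝ} (hM : ∀ n, ‖x n‖ ≤ M) {g : C(K, ℝ)}
    (hg : ∀ k, Tendsto (fun n => (x n : C(K, ℝ)) k) atTop (𝓝 (g k))) : g ∈ X := by
  rw [← SetLike.mem_coe, ← hX.closure_eq, Metric.mem_closure_iff]
  intro ε hε
  obtain ⟨w, hw, hwlt⟩ := exists_isTailWeight_forall_lt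
    (q := fun n => |(x n : C(K, ℝ)) - g|) (M := M + ‖g‖) (fun n k => by
      have h1 := (x n : C(K, ℝ)).norm_coe_le_norm k
      have h2 := g.norm_coe_le_norm k
      have h3 := hM n
      rw [ContinuousMap.abs_apply, abs_abs, ContinuousMap.sub_apply]
      refine (abs_sub _ _).trans ?_
      exact add_le_add (h1.trans h3) h2) (fun k => by
      have := ((hg k).sub_const (g k)).abs
      simpa using this) 0 (half_pos hε)
  refine ⟨((w.linearCombination ℝ x : X) : C(K, ℝ)), Subtype.coe_prop _, ?_⟩
  refine lt_of_le_of_lt ?_ (half_lt_self hε)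
  rw [dist_comm, dist_eq_norm, ContinuousMap.norm_le _ (half_pos hε).le]
  intro k
  have h1 : ((w.linearCombination ℝ x : X) : C(K, ℝ)) =
      w.linearCombination ℝ fun i => (x i : C(K, ℝ)) :=
    Finsupp.apply_linearCombination ℝ X.subtype x w
  rw [h1, ContinuousMap.sub_apply, linearCombination_continuousMap_apply,
    hw.linearCombination_sub_const]
  exact (hw.norm_linearCombination_le _).trans (hwlt k).le

/-- A function in `X**` of the first Baire class is a bounded pointwise limit of elements of
`X`. -/
theorem MemBidual.exists_seq {X : Submodule ℝ C(K, ℝ)} {F : K → ℝ} (h : MemBidual X F) :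
    ∃ (x : ℕ → X) (M : ℝ), (∀ n, ‖x n‖ ≤ M) ∧
      ∀ k, Tendsto (fun n => (x n : C(K, ℝ)) k) atTop (𝓝 (F k)) := by
  obtain ⟨ψ, Φ, hΦ, ⟨f, hf⟩, hF⟩ := h
  -- Convex combinations of later and later tails of `f` still converge pointwise to `F`, and so do
  -- elements of `X` uniformly close to them.
  obtain ⟨M, key⟩ := exists_norm_le_and_norm_sub_linearCombination_lt (Y := X) X.subtypeL ψ
    (f := f) fun ℓ => by simpa only [hΦ ℓ] using! hf ℓ
  choose x hx w hw hxw using fun n : ℕ => key n (1 / ((n : ℝ) + 1)) (by positivity)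
  refine ⟨x, M, hx, fun k => ?_⟩
  have h1 : Tendsto (fun n => f n k) atTop (𝓝 (F k)) := by
    rw [← hF k]
    exact hf (ContinuousMap.evalCLM ℝ k)
  have h2 := IsTailWeight.tendsto_linearCombination tendsto_id hw h1
  have h3 : Tendsto (fun n => (x n : C(K, ℝ)) k - (w n).linearCombination ℝ fun i => f i k)
      atTop (𝓝 0) := by
    refine squeeze_zero_norm (fun n => ?_) tendsto_one_div_add_atTop_nhds_zero_nat
    rw [← linearCombination_continuousMap_apply, ← ContinuousMap.sub_apply]
    exact (ContinuousMap.norm_coe_le_norm _ k).trans (hxw n).le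
  simpa using h3.add h2

end PointwiseNull

/-! ### Basic subsequences dominating the summing basis -/

section DominatesSumming

set_option linter.unusedSectionVars false

variable {K : Type*} [MetricSpace K] [CompactSpace K]

/-- The unit sphere of `V` is compact, so finitely many evaluation points norm it up to the factor
`2`. -/
theorem exists_finset_norm_le_two_mul_abs_apply [Nonempty K] (V : Submodule ℝ C(K, ℝ))
    [FiniteDimensional ℝ V] : ∃ T : Finset K, ∀ v ∈ V, ∃ k ∈ T, ‖v‖ ≤ 2 * |v k| := by
  classical
  have hproper : ProperSpace V := FiniteDimensional.proper_real V
  obtain ⟨T, hT⟩ := (isCompact_sphere (0 : V) 1).elim_finite_subcover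
    (fun k : K => {v : V | 1 / 2 < |(v : C(K, ℝ)) k|})
    (fun k => isOpen_lt continuous_const
      (((continuous_eval_const k).comp continuous_subtype_val).abs))
    (fun v hv => by
      by_contra hcon
      simp only [Set.mem_iUnion, Set.mem_ofPred_eq, not_exists, not_lt] at hcon
      have h1 : ‖(v : C(K, ℝ))‖ ≤ 1 / 2 :=
        (ContinuousMap.norm_le _ (by norm_num)).2 hcon
      have h2 : ‖(v : C(K, ℝ))‖ = 1 := by simpa using hv
      linarith)
  obtain ⟨k₀⟩ := ‹Nonempty K›
  refine ⟨insert k₀ T, fun v hv => ?_⟩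
  by_cases h0 : v = 0
  · exact ⟨k₀, Finset.mem_insert_self _ _, by simp [h0]⟩
  have hpos : 0 < ‖v‖ := norm_pos_iff.2 h0
  have hmem : (⟨‖v‖⁻¹ • v, V.smul_mem _ hv⟩ : V) ∈ Metric.sphere (0 : V) 1 := by
    rw [mem_sphere_zero_iff_norm]
    change ‖‖v‖⁻¹ • v‖ = 1
    rw [norm_smul, norm_inv, norm_norm,
      inv_mul_cancel₀ hpos.ne']
  obtain ⟨k, hk, hlt⟩ := Set.mem_iUnion₂.1 (hT hmem)
  refine ⟨k, Finset.mem_insert_of_mem hk, ?_⟩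
  have h1 : 1 / 2 < ‖v‖⁻¹ * |v k| := by
    simpa [abs_mul, abs_of_nonneg] using hlt
  rw [inv_mul_eq_div, lt_div_iff₀ hpos] at h1
  linarith

theorem abs_sum_mul_sub_le {I : Finset ℕ} {a g : ℕ → ℝ} {c S η : ℝ} (hS : 0 ≤ S) (hη : 0 ≤ η)
    (ha : ∀ i ∈ I, |a i| ≤ 2 * S) (hg : ∀ i ∈ I, |g i - c| ≤ η * (1 / 2) ^ i) :
    |∑ i ∈ I, a i * g i - c * ∑ i ∈ I, a i| ≤ 4 * S * η := by
  obtain ⟨N, hN⟩ := I.exists_nat_subset_range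
  have h1 : ∑ i ∈ I, a i * g i - c * ∑ i ∈ I, a i = ∑ i ∈ I, a i * (g i - c) := by
    rw [Finset.mul_sum, ← Finset.sum_sub_distrib]
    exact Finset.sum_congr rfl fun i _ => by ring
  rw [h1]
  calc |∑ i ∈ I, a i * (g i - c)| ≤ ∑ i ∈ I, 2 * S * η * (1 / 2) ^ i := by
        refine (Finset.abs_sum_le_sum_abs _ _).trans (Finset.sum_le_sum fun i hi => ?_)
        rw [abs_mul, mul_assoc (2 * S)]
        exact mul_le_mul (ha i hi) (hg i hi) (abs_nonneg _) (by positivity)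
    _ ≤ ∑ i ∈ Finset.range N, 2 * S * η * (1 / 2) ^ i :=
        Finset.sum_le_sum_of_subset_of_nonneg hN fun i _ _ => by positivity
    _ ≤ 4 * S * η := by
        rw [← Finset.mul_sum]
        have := sum_geometric_two_le N
        have h2 : 0 ≤ 2 * S * η := by positivity
        nlinarith

theorem exists_frequently_le_abs_sub {F : K → ℝ} (hF : ¬ Continuous F) :
    ∃ k₀, ∃ δ > 0, ∃ᶠ t in 𝓝 k₀, δ ≤ |F t - F k₀| := by
  rw [continuous_iff_continuousAt] at hF
  push Not at hF
  obtain ⟨k₀, hk₀⟩ := hF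
  rw [ContinuousAt, Metric.tendsto_nhds] at hk₀
  push Not at hk₀
  obtain ⟨δ, hδ, h⟩ := hk₀
  exact ⟨k₀, δ, hδ, h.mono fun t ht => by simpa [Real.dist_eq] using ht⟩

/-- A bounded sequence of continuous functions converging pointwise to a discontinuous function
has a subsequence that dominates the summing basis and has bounded initial-segment projections. -/
theorem exists_strictMono_prefixBound {F : K → ℝ} (hF : ¬ Continuous F) {x : ℕ → C(K, ℝ)} {M : ℝ}
    (hM : ∀ n, ‖x n‖ ≤ M) (hx : ∀ k, Tendsto (fun n => x n k) atTop (𝓝 (F k))) :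
    ∃ φ : ℕ → ℕ, StrictMono φ ∧ ∃ C : ℝ, 0 < C ∧
      (∀ (a : ℕ → ℝ) (m N : ℕ), m ≤ N →
        |∑ i ∈ Finset.range m, a i| ≤ C * ‖∑ i ∈ Finset.range N, a i • x (φ i)‖) ∧
      PrefixBound (x ∘ φ) C := by
  classical
  have hM0 : 0 ≤ M := (norm_nonneg _).trans (hM 0)
  have hFM : ∀ k, |F k| ≤ M := fun k =>
    le_of_tendsto' (hx k).abs fun n => ((x n).norm_coe_le_norm k).trans (hM n)
  obtain ⟨k₀, δ, hδ, hfreq⟩ := exists_frequently_le_abs_sub hF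
  have hne : Nonempty K := ⟨k₀⟩
  -- Chosen so that the total error `32 * S * η` below is half of `S * δ` and can be absorbed.
  set η := δ / 64 with hη
  have hηpos : 0 < η := by positivity
  -- At `t` the limit `F` has already jumped, while the finitely many functions chosen so far still
  -- take nearly their values at `k₀`.
  have ht : ∀ A : Finset ℕ, ∃ t, δ ≤ |F t - F k₀| ∧
      ∀ i ∈ A, |x i t - x i k₀| ≤ η * (1 / 2) ^ A.card := by
    intro A
    refine (hfreq.and_eventually ?_).exists
    rw [Finset.eventually_all]
    intro i _
    have h1 := Metric.tendsto_nhds.1 ((x i).continuous.tendsto k₀) (η * (1 / 2) ^ A.card)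
      (by positivity)
    exact h1.mono fun t ht => by simpa [Real.dist_eq] using ht.le
  choose t htδ htx using ht
  have hT : ∀ A : Finset ℕ, ∃ T : Finset K, ∀ a : ℕ → ℝ,
      ∃ k ∈ T, ‖∑ i ∈ A, a i • x i‖ ≤ 2 * |(∑ i ∈ A, a i • x i) k| := by
    intro A
    have hfin : FiniteDimensional ℝ (Submodule.span ℝ ((A.image x : Finset C(K, ℝ)) : Set C(K, ℝ))) :=
      FiniteDimensional.span_finset ℝ _
    obtain ⟨T, hT⟩ := exists_finset_norm_le_two_mul_abs_apply
      (Submodule.span ℝ ((A.image x : Finset C(K, ℝ)) : Set C(K, ℝ)))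
    exact ⟨T, fun a => hT _ (Submodule.sum_mem _ fun i hi => Submodule.smul_mem _ _
      (Submodule.subset_span (Finset.mem_image_of_mem x hi)))⟩
  choose T hT using hT
  -- The new function must be close to `F` at `k₀`, at the jump points and at the norming points
  -- attached to every set of earlier indices.
  obtain ⟨φ, hφ⟩ := exists_seq_of_forall_finset
    (fun A n => (∀ m ∈ A, m < n) ∧ ∀ B ∈ A.powerset, ∀ k ∈ insert k₀ (insert (t B) (T B)),
      |x n k - F k| ≤ η * (1 / 2) ^ A.card) fun A => by
    refine Eventually.exists (f := atTop) (Eventually.and ?_ ?_)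
    · rw [Finset.eventually_all]
      exact fun m _ => eventually_gt_atTop m
    · simp only [Finset.eventually_all]
      intro B _ k _
      have h1 := Metric.tendsto_nhds.1 (hx k) (η * (1 / 2) ^ A.card) (by positivity)
      exact h1.mono fun n hn => by simpa [Real.dist_eq] using hn.le
  have hmono : StrictMono φ := strictMono_nat_of_lt_succ fun n =>
    (hφ (n + 1)).1 _ (Finset.mem_image_of_mem φ (by simp))
  have hcard : ∀ j, ((Finset.range j).image φ).card = j := fun j => by
    rw [Finset.card_image_of_injective _ hmono.injective, Finset.card_range]
  have hnear : ∀ i j, i ≤ j → ∀ k ∈ insert k₀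
      (insert (t ((Finset.range i).image φ)) (T ((Finset.range i).image φ))),
      |x (φ j) k - F k| ≤ η * (1 / 2) ^ j := by
    intro i j hij k hk
    have := (hφ j).2 ((Finset.range i).image φ) (Finset.mem_powerset.2
      (Finset.image_subset_image (Finset.range_mono hij))) k hk
    rwa [hcard] at this
  have hk₀near : ∀ j, |x (φ j) k₀ - F k₀| ≤ η * (1 / 2) ^ j := fun j =>
    hnear j j le_rfl _ (Finset.mem_insert_self _ _)
  have hval : ∀ (a : ℕ → ℝ) (N : ℕ) (k : K), (∑ i ∈ Finset.range N, a i • x (φ i)) k =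
      ∑ i ∈ Finset.range N, a i * x (φ i) k := fun a N k => by
    rw [ContinuousMap.sum_apply]
    rfl
  have hsplit : ∀ (g : ℕ → ℝ) {m N : ℕ}, m ≤ N → ∑ i ∈ Finset.range N, g i =
      ∑ i ∈ Finset.range m, g i + ∑ i ∈ Finset.Ico m N, g i := fun g m N hmN =>
    (Finset.sum_range_add_sum_Ico g hmN).symm
  have hmax : ∀ (a : ℕ → ℝ) (N : ℕ), ∃ S, 0 ≤ S ∧
      (∀ j ≤ N, |∑ i ∈ Finset.range j, a i| ≤ S) ∧ (∀ i < N, |a i| ≤ 2 * S) ∧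
      S ≤ 8 / δ * ‖∑ i ∈ Finset.range N, a i • x (φ i)‖ := by
    intro a N
    obtain ⟨j₀, hj₀, hj₀max⟩ := Finset.exists_max_image (Finset.range (N + 1))
      (fun j => |∑ i ∈ Finset.range j, a i|) ⟨0, by simp⟩
    set S := |∑ i ∈ Finset.range j₀, a i| with hS
    have hS0 : 0 ≤ S := abs_nonneg _
    have hle : ∀ j ≤ N, |∑ i ∈ Finset.range j, a i| ≤ S := fun j hj =>
      hj₀max j (Finset.mem_range.2 (Nat.lt_succ_of_le hj))
    have ha : ∀ i < N, |a i| ≤ 2 * S := by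
      intro i hi
      have h1 := abs_le.1 (hle i hi.le)
      have h2 := abs_le.1 (hle (i + 1) hi)
      rw [Finset.sum_range_succ] at h2
      rw [abs_le]
      constructor <;> linarith [h1.1, h1.2, h2.1, h2.2]
    refine ⟨S, hS0, hle, ha, ?_⟩
    set y := ∑ i ∈ Finset.range N, a i • x (φ i) with hy
    have hyk : ∀ k, |y k| ≤ ‖y‖ := y.norm_coe_le_norm
    have e0 : |y k₀ - F k₀ * ∑ i ∈ Finset.range N, a i| ≤ 4 * S * η := by
      rw [hval]
      exact abs_sum_mul_sub_le hS0 hηpos.le (fun i hi => ha i (Finset.mem_range.1 hi))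
        fun i _ => hk₀near i
    -- At `k₀` all terms are near `F k₀`; at `τ` those before `j` are near `F k₀` and those from `j`
    -- on near `F τ`. Subtracting the two values of `y` isolates `F τ - F k₀` times the tail sum.
    have main : ∀ j ≤ N, |∑ i ∈ Finset.range N, a i - ∑ i ∈ Finset.range j, a i| * δ ≤
        2 * ‖y‖ + 16 * S * η := by
      intro j hj
      set τ := t ((Finset.range j).image φ) with hτ
      have e1 : |∑ i ∈ Finset.range j, a i * x (φ i) τ - F k₀ * ∑ i ∈ Finset.range j, a i| ≤
          4 * S * (2 * η) := by
        refine abs_sum_mul_sub_le hS0 (by positivity)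
          (fun i hi => ha i ((Finset.mem_range.1 hi).trans_le hj)) fun i hi => ?_
        have h1 := htx ((Finset.range j).image φ) (φ i) (Finset.mem_image_of_mem φ hi)
        rw [hcard] at h1
        have h2 := hk₀near i
        have h3 : ((1 : ℝ) / 2) ^ j ≤ (1 / 2) ^ i :=
          pow_le_pow_of_le_one (by norm_num) (by norm_num) (Finset.mem_range.1 hi).le
        have h4 := mul_le_mul_of_nonneg_left h3 hηpos.le
        have h5 := abs_sub_le (x (φ i) τ) (x (φ i) k₀) (F k₀)
        linarith
      have e2 : |∑ i ∈ Finset.Ico j N, a i * x (φ i) τ - F τ * ∑ i ∈ Finset.Ico j N, a i| ≤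
          4 * S * η :=
        abs_sum_mul_sub_le hS0 hηpos.le (fun i hi => ha i (Finset.mem_Ico.1 hi).2) fun i hi =>
          hnear j i (Finset.mem_Ico.1 hi).1 τ
            (Finset.mem_insert_of_mem (Finset.mem_insert_self _ _))
      have e3 : y τ = ∑ i ∈ Finset.range j, a i * x (φ i) τ +
          ∑ i ∈ Finset.Ico j N, a i * x (φ i) τ := by rw [hval, hsplit _ hj]
      have e4 := hsplit a hj
      have h6 : ∑ i ∈ Finset.range N, a i - ∑ i ∈ Finset.range j, a i =
          ∑ i ∈ Finset.Ico j N, a i := by rw [e4]; ring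
      have h7 : |∑ i ∈ Finset.Ico j N, a i| * |F τ - F k₀| ≤ 2 * ‖y‖ + 16 * S * η := by
        rw [← abs_mul]
        rw [e4] at e0
        have h8 := hyk k₀
        have h9 := hyk τ
        rw [e3] at h9
        rw [abs_le] at *
        constructor <;> nlinarith [e0.1, e0.2, e1.1, e1.2, e2.1, e2.2, h8.1, h8.2, h9.1, h9.2]
      rw [h6]
      exact (mul_le_mul_of_nonneg_left (htδ _) (abs_nonneg _)).trans h7
    have m0 := main 0 (Nat.zero_le _)
    have m1 := main j₀ (Nat.le_of_lt_succ (Finset.mem_range.1 hj₀))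
    rw [Finset.sum_range_zero, sub_zero] at m0
    have h10 : S ≤ |∑ i ∈ Finset.range N, a i| +
        |∑ i ∈ Finset.range N, a i - ∑ i ∈ Finset.range j₀, a i| := by
      rw [hS]
      have := abs_sub (∑ i ∈ Finset.range N, a i)
        (∑ i ∈ Finset.range N, a i - ∑ i ∈ Finset.range j₀, a i)
      rwa [sub_sub_cancel] at this
    have h11 : S * δ ≤ 4 * ‖y‖ + 32 * S * η := by nlinarith
    rw [div_mul_eq_mul_div, le_div_iff₀ hδ]
    rw [hη] at h11
    linarith
  -- The second entry bounds a prefix: its norm is at most twice its value at a norming point, and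
  -- there the remaining terms contribute at most `2 * M * S + 4 * S * η`.
  refine ⟨φ, hmono, max (8 / δ) (2 + (4 * M + 8 * η) * (8 / δ)), ?_, ?_, ?_⟩
  · exact lt_max_of_lt_left (by positivity)
  · intro a m N hmN
    obtain ⟨S, -, hS, -, hSle⟩ := hmax a N
    exact ((hS m hmN).trans hSle).trans
      (mul_le_mul_of_nonneg_right (le_max_left _ _) (norm_nonneg _))
  · intro a m N hmN
    simp only [Function.comp_apply]
    obtain ⟨S, hS0, hS, ha, hSle⟩ := hmax a N
    set y := ∑ i ∈ Finset.range N, a i • x (φ i) with hy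
    refine le_trans ?_ (mul_le_mul_of_nonneg_right (le_max_right _ _) (norm_nonneg _))
    obtain ⟨k, hk, hle⟩ := hT ((Finset.range m).image φ) (Function.extend φ a 0)
    rw [Finset.sum_image hmono.injective.injOn] at hle
    simp only [hmono.injective.extend_apply] at hle
    have e1 : |∑ i ∈ Finset.Ico m N, a i * x (φ i) k - F k * ∑ i ∈ Finset.Ico m N, a i| ≤
        4 * S * η :=
      abs_sum_mul_sub_le hS0 hηpos.le (fun i hi => ha i (Finset.mem_Ico.1 hi).2) fun i hi =>
        hnear m i (Finset.mem_Ico.1 hi).1 k (Finset.mem_insert_of_mem (Finset.mem_insert_of_mem hk))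
    have e2 : |∑ i ∈ Finset.Ico m N, a i| ≤ 2 * S := by
      have h1 := abs_le.1 (hS m hmN)
      have h2 := abs_le.1 (hS N le_rfl)
      rw [hsplit a hmN] at h2
      rw [abs_le]
      constructor <;> linarith [h1.1, h1.2, h2.1, h2.2]
    have e3 : |F k * ∑ i ∈ Finset.Ico m N, a i| ≤ M * (2 * S) := by
      rw [abs_mul]
      exact mul_le_mul (hFM k) e2 (abs_nonneg _) hM0
    have e4 : |y k| ≤ ‖y‖ := y.norm_coe_le_norm k
    rw [hy, hval, hsplit _ hmN, ← hy] at e4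
    rw [hval] at hle
    have e5 : |∑ i ∈ Finset.range m, a i * x (φ i) k| ≤ ‖y‖ + M * (2 * S) + 4 * S * η := by
      rw [abs_le] at *
      constructor <;> linarith [e1.1, e1.2, e3.1, e3.2, e4.1, e4.2]
    have e6 : (4 * M + 8 * η) * S ≤ (4 * M + 8 * η) * (8 / δ * ‖y‖) :=
      mul_le_mul_of_nonneg_left hSle (by positivity)
    nlinarith

end DominatesSumming

/-! ### Convex blocks for functions in `B_{1/4}(K)` -/

section Blocks

theorem IsTailWeight.linearCombination_mono {N : ℕ} {w : ℕ →₀ ℝ} (hw : IsTailWeight N w)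
    {g h : ℕ → ℝ} (hgh : ∀ i, g i ≤ h i) : w.linearCombination ℝ g ≤ w.linearCombination ℝ h := by
  rw [Finsupp.linearCombination_apply, Finsupp.linearCombination_apply]
  exact Finset.sum_le_sum fun i _ => mul_le_mul_of_nonneg_left (hgh i) (hw.1 i)

theorem Finsupp.linearCombination_sub_left {V : Type*} [AddCommGroup V] [Module ℝ V]
    (w : ℕ →₀ ℝ) (g h : ℕ → V) : w.linearCombination ℝ (fun i => g i - h i) =
      w.linearCombination ℝ g - w.linearCombination ℝ h := by
  simp only [Finsupp.linearCombination_apply, Finsupp.sum, smul_sub, Finset.sum_sub_distrib]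

theorem IsTailWeight.le_linearCombination {N : ℕ} {w : ℕ →₀ ℝ} (hw : IsTailWeight N w)
    {g : ℕ → ℝ} {B : ℝ} (hg : ∀ i, N ≤ i → w i ≠ 0 → B ≤ g i) : B ≤ w.linearCombination ℝ g := by
  have h1 := hw.linearCombination_le (g := fun i => 0 - g i) (B := -B) fun i hi hi0 => by
    linarith [hg i hi hi0]
  rw [Finsupp.linearCombination_sub_left] at h1
  have h2 : w.linearCombination ℝ (fun _ => (0 : ℝ)) = 0 := by
    simp [Finsupp.linearCombination_apply]
  linarith

/-- Successive choice of convex weights in consecutive blocks. -/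
theorem exists_successive_isTailWeight {Q : ℕ → (ℕ →₀ ℝ) → Prop}
    (h : ∀ n N, ∃ w, IsTailWeight N w ∧ Q n w) :
    ∃ (N : ℕ → ℕ) (w : ℕ → ℕ →₀ ℝ), StrictMono N ∧ (∀ n, IsTailWeight (N n) (w n)) ∧
      (∀ n, Q n (w n)) ∧ ∀ n i, w n i ≠ 0 → i < N (n + 1) := by
  have h' : ∀ n N, ∃ w B, IsTailWeight N w ∧ Q n w ∧ ∀ i, w i ≠ 0 → i < B := by
    intro n N
    obtain ⟨w, hw, hQ⟩ := h n N
    obtain ⟨B, hB⟩ := w.support.exists_nat_subset_range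
    exact ⟨w, B, hw, hQ, fun i hi => Finset.mem_range.1 (hB (Finsupp.mem_support_iff.2 hi))⟩
  choose w B hw hQ hB using h'
  let N : ℕ → ℕ := fun n => Nat.rec 0 (fun n m => max (m + 1) (B n m)) n
  exact ⟨N, fun n => w n (N n), strictMono_nat_of_lt_succ fun n =>
      Nat.lt_of_succ_le (le_max_left _ _),
    fun n => hw n (N n), fun n => hQ n (N n),
    fun n i hi => (hB n (N n) i hi).trans_le (le_max_right _ _)⟩

/-- The weights live on consecutive blocks, so every value averaged by one is at most every value
averaged by the next. -/
theorem monotone_linearCombination_of_successive {N : ℕ → ℕ} {w : ℕ → ℕ →₀ ℝ}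
    (hw : ∀ n, IsTailWeight (N n) (w n)) (hwN : ∀ n i, w n i ≠ 0 → i < N (n + 1)) {v : ℕ → ℝ}
    (hv : Monotone v) : Monotone fun n => (w n).linearCombination ℝ v :=
  monotone_nat_of_le_succ fun n =>
    ((hw n).linearCombination_le fun i _ hi => hv (hwN n i hi).le).trans
      ((hw (n + 1)).le_linearCombination fun _ hi _ => hv hi)

/-- Abel summation: the increments of `u` are nonnegative and add up to at most `V`. -/
theorem abs_sum_mul_monotone_le {u a : ℕ → ℝ} {V S : ℝ} {m : ℕ} (hu : Monotone u)
    (hu0 : ∀ n, 0 ≤ u n) (huV : ∀ n, u n ≤ V)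
    (ha : ∀ j ≤ m, |∑ i ∈ Finset.range j, a i| ≤ S) :
    |∑ i ∈ Finset.range m, a i * u i| ≤ 2 * (S * V) := by
  have key : ∀ j ≤ m, |∑ i ∈ Finset.range j, a i * u i - (∑ i ∈ Finset.range j, a i) * u j| ≤
      S * (u j - u 0) := by
    intro j
    induction j with
    | zero => simp
    | succ j ih =>
      intro hj
      have h1 := ih (Nat.le_of_succ_le hj)
      have h2 : |(∑ i ∈ Finset.range (j + 1), a i) * (u (j + 1) - u j)| ≤
          S * (u (j + 1) - u j) := by
        rw [abs_mul, abs_of_nonneg (sub_nonneg.2 (hu (Nat.le_succ j)))]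
        exact mul_le_mul_of_nonneg_right (ha _ hj) (sub_nonneg.2 (hu (Nat.le_succ j)))
      have h3 : ∑ i ∈ Finset.range (j + 1), a i * u i -
          (∑ i ∈ Finset.range (j + 1), a i) * u (j + 1) =
          (∑ i ∈ Finset.range j, a i * u i - (∑ i ∈ Finset.range j, a i) * u j) -
            (∑ i ∈ Finset.range (j + 1), a i) * (u (j + 1) - u j) := by
        rw [Finset.sum_range_succ, Finset.sum_range_succ]; ring
      rw [h3]
      refine (abs_sub _ _).trans ?_
      linarith
  have hS : 0 ≤ S := (abs_nonneg _).trans (ha 0 (Nat.zero_le _))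
  have h1 := key m le_rfl
  have h2 : |(∑ i ∈ Finset.range m, a i) * u m| ≤ S * V := by
    rw [abs_mul, abs_of_nonneg (hu0 m)]
    exact mul_le_mul (ha m le_rfl) (huV m) (hu0 m) hS
  have h3 : S * (u m - u 0) ≤ S * V :=
    mul_le_mul_of_nonneg_left (by linarith [hu0 0, huV m]) hS
  have h4 := abs_le.1 h1
  have h5 := abs_le.1 h2
  rw [abs_le]
  constructor <;> linarith [h4.1, h4.2, h5.1, h5.2]

/-- A sequence of bounded variation starting at `0` is a difference of two bounded monotone
sequences. -/
theorem exists_monotone_sub_monotone {g : ℕ → ℝ} {C : ℝ} (h0 : g 0 = 0)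
    (hg : ∀ N, ∑ n ∈ Finset.range N, |g (n + 1) - g n| ≤ C) :
    ∃ v w : ℕ → ℝ, Monotone v ∧ Monotone w ∧ (∀ n, 0 ≤ v n ∧ v n ≤ C) ∧
      (∀ n, 0 ≤ w n ∧ w n ≤ 2 * C) ∧ ∀ n, g n = v n - w n := by
  let v : ℕ → ℝ := fun N => ∑ n ∈ Finset.range N, |g (n + 1) - g n|
  have hvs : ∀ n, v (n + 1) = v n + |g (n + 1) - g n| := fun n => Finset.sum_range_succ _ _
  have hv : Monotone v := monotone_nat_of_le_succ fun n => by
    rw [hvs]; linarith [abs_nonneg (g (n + 1) - g n)]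
  have hw : Monotone fun n => v n - g n := monotone_nat_of_le_succ fun n => by
    rw [hvs]; linarith [le_abs_self (g (n + 1) - g n)]
  have hw' : Monotone fun n => v n + g n := monotone_nat_of_le_succ fun n => by
    rw [hvs]; linarith [neg_abs_le (g (n + 1) - g n)]
  have hv0 : v 0 = 0 := Finset.sum_range_zero _
  refine ⟨v, fun n => v n - g n, hv, hw, fun n => ⟨?_, hg n⟩, fun n => ⟨?_, ?_⟩, fun n => by ring⟩
  · rw [← hv0]; exact hv (Nat.zero_le n)
  · have : v 0 - g 0 ≤ v n - g n := hw (Nat.zero_le n)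
    rwa [hv0, h0, sub_zero] at this
  · have h1 : v 0 + g 0 ≤ v n + g n := hw' (Nat.zero_le n)
    rw [hv0, h0, add_zero] at h1
    have h2 : v n ≤ C := hg n
    linarith

set_option linter.unusedSectionVars false

variable {K : Type*} [MetricSpace K] [CompactSpace K]

theorem VariationBound.sum_range_le_and_abs_le {f : ℕ → C(K, ℝ)} {C : ℝ} (h0 : f 0 = 0)
    (hf : ∀ k, Summable (fun n => |f (n + 1) k - f n k|) ∧ ∑' n, |f (n + 1) k - f n k| ≤ C)
    (k : K) (N : ℕ) : ∑ n ∈ Finset.range N, |f (n + 1) k - f n k| ≤ C ∧ |f N k| ≤ C := by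
  have h1 := ((hf k).1.sum_le_tsum (Finset.range N) fun _ _ => abs_nonneg _).trans (hf k).2
  refine ⟨h1, le_trans ?_ h1⟩
  have h2 := Finset.sum_range_sub (fun n => f n k) N
  rw [h0, ContinuousMap.zero_apply, sub_zero] at h2
  rw [← h2]
  exact Finset.abs_sum_le_sum_abs _ _

/-- The excesses `(|x i - g m i| - ε m)⁺` are bounded and pointwise null in `i`. Making a convex
combination of their sum over `m ≤ n` uniformly small yields one weight that serves all these `m` at
once. -/
theorem exists_isTailWeight_norm_sub_le {F : K → ℝ} {x : ℕ → C(K, ℝ)} {M C : ℝ}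
    (hM : ∀ n, ‖x n‖ ≤ M) (hx : ∀ k, Tendsto (fun n => x n k) atTop (𝓝 (F k)))
    {G : ℕ → K → ℝ} {g : ℕ → ℕ → C(K, ℝ)} (hgC : ∀ m n k, |g m n k| ≤ C)
    (hg : ∀ m k, Tendsto (fun n => g m n k) atTop (𝓝 (G m k))) {ε : ℕ → ℝ}
    (hε : ∀ m, 0 < ε m) (hFG : ∀ m k, |F k - G m k| ≤ ε m) (n N : ℕ) {η : ℝ} (hη : 0 < η) :
    ∃ w, IsTailWeight N w ∧ ∀ m ≤ n,
      ‖w.linearCombination ℝ x - w.linearCombination ℝ (g m)‖ ≤ ε m + η := by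
  let q : ℕ → ℕ → C(K, ℝ) := fun m i => (|x i - g m i| - ContinuousMap.const K (ε m)) ⊔ 0
  have hqa : ∀ m i k, q m i k = max (|x i k - g m i k| - ε m) 0 := fun m i k => rfl
  have hq0 : ∀ m i k, 0 ≤ q m i k := fun m i k => by rw [hqa]; exact le_max_right _ _
  have hqM : ∀ m i k, q m i k ≤ M + C := fun m i k => by
    have h1 := ((x i).norm_coe_le_norm k).trans (hM i)
    have h2 := hgC m i k
    rw [Real.norm_eq_abs] at h1
    rw [hqa]
    refine max_le ?_ ?_
    · have := abs_sub (x i k) (g m i k)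
      linarith [hε m]
    · linarith [abs_nonneg (x i k), abs_nonneg (g m i k)]
  have hqlim : ∀ m k, Tendsto (fun i => q m i k) atTop (𝓝 0) := fun m k => by
    have h1 := ((((hx k).sub (hg m k)).abs.sub_const (ε m)).max
      (tendsto_const_nhds (x := (0 : ℝ))))
    rwa [max_eq_right (sub_nonpos.2 (hFG m k))] at h1
  have hsum : ∀ i k, (∑ m ∈ Finset.range (n + 1), q m i) k =
      ∑ m ∈ Finset.range (n + 1), q m i k := fun i k => by rw [ContinuousMap.sum_apply]
  obtain ⟨w, hw, hwlt⟩ := exists_isTailWeight_forall_lt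
    (q := fun i => ∑ m ∈ Finset.range (n + 1), q m i)
    (M := ∑ m ∈ Finset.range (n + 1), (M + C)) (fun i k => by
      rw [hsum, abs_of_nonneg (Finset.sum_nonneg fun m _ => hq0 m i k)]
      exact Finset.sum_le_sum fun m _ => hqM m i k) (fun k => by
      simp only [hsum]
      simpa using tendsto_finsetSum (Finset.range (n + 1)) fun m _ => hqlim m k) N hη
  refine ⟨w, hw, fun m hm => ?_⟩
  rw [ContinuousMap.norm_le _ (add_pos (hε m) hη).le]
  intro k
  rw [ContinuousMap.sub_apply, linearCombination_continuousMap_apply,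
    linearCombination_continuousMap_apply, ← Finsupp.linearCombination_sub_left]
  refine (hw.norm_linearCombination_le _).trans ?_
  rw [← sub_le_iff_le_add', hw.linearCombination_sub_const]
  refine le_trans (hw.linearCombination_mono fun i => ?_) (hwlt k).le
  rw [hsum]
  refine le_trans ?_ (Finset.single_le_sum (f := fun m => q m i k) (fun m _ => hq0 m i k)
    (Finset.mem_range.2 (Nat.lt_succ_of_le hm)))
  rw [hqa]
  exact le_max_left _ _

theorem BaireQuarter.exists_approx {F : K → ℝ} (hF : BaireQuarter F) :
    ∃ (C : ℝ) (G : ℕ → K → ℝ), 0 ≤ C ∧ (∀ m k, |F k - G m k| ≤ 1 / ((m : ℝ) + 1)) ∧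
      ∀ m, ∃ c ≤ C, VariationBound (G m) c := by
  obtain ⟨-, G, hG, ⟨B, hB⟩, hlim⟩ := hF
  have hsub : ∀ m : ℕ, ∃ n, ∀ k, |F k - G n k| ≤ 1 / ((m : ℝ) + 1) := fun m => by
    obtain ⟨n, hn⟩ := (Metric.tendstoUniformly_iff.1 hlim (1 / ((m : ℝ) + 1))
      (by positivity)).exists
    exact ⟨n, fun k => (hn k).le⟩
  choose n hn using hsub
  refine ⟨max (B + 1) 0, fun m => G (n m), le_max_right _ _, hn, fun m => ?_⟩
  have h1 : sInf {C : ℝ | VariationBound (G (n m)) C} < B + 1 :=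
    (hB ⟨n m, rfl⟩).trans_lt (lt_add_one B)
  obtain ⟨c, hc, hcB⟩ := exists_lt_of_csInf_lt (hG (n m)) h1
  exact ⟨c, hcB.le.trans (le_max_left _ _), hc⟩

/-- A bounded sequence from `X` converging pointwise to a function in `B_{1/4}(K)` has convex
blocks whose sufficiently late finite pieces are uniformly dominated by the summing basis. -/
theorem BaireQuarter.exists_late_summing_upper {F : K → ℝ} (hF : BaireQuarter F)
    {X : Submodule ℝ C(K, ℝ)} {x : ℕ → X} {M : ℝ} (hM : ∀ n, ‖x n‖ ≤ M)
    (hx : ∀ k, Tendsto (fun n => (x n : C(K, ℝ)) k) atTop (𝓝 (F k))) :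
    ∃ h : ℕ → X, (∀ n, ‖h n‖ ≤ M) ∧
      (∀ k, Tendsto (fun n => (h n : C(K, ℝ)) k) atTop (𝓝 (F k))) ∧
      ∃ C > 0, ∀ (m : ℕ) (n : ℕ → ℕ), StrictMono n → m ≤ n 0 → ∀ (a : ℕ → ℝ) (S : ℝ),
        (∀ j ≤ m, |∑ i ∈ Finset.range j, a i| ≤ S) →
          ‖∑ i ∈ Finset.range m, a i • h (n i)‖ ≤ C * S := by
  obtain ⟨C, G, hC0, hFG, hvar⟩ := hF.exists_approx
  choose c hcC _ g hg0 hglim hgvar using hvar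
  have hgb : ∀ p k N, ∑ n ∈ Finset.range N, |g p (n + 1) k - g p n k| ≤ C ∧ |g p N k| ≤ C :=
    fun p k N =>
      let h := VariationBound.sum_range_le_and_abs_le (hg0 p) (hgvar p) k N
      ⟨h.1.trans (hcC p), h.2.trans (hcC p)⟩
  -- Block `n` is close to the corresponding block of every approximant `g p` with `p ≤ n`. Hence
  -- `m` blocks with indices at least `m` can all be compared with the single approximant `g m`.
  obtain ⟨N, w, hN, hw, hQ, hwN⟩ := exists_successive_isTailWeight fun n N =>
    exists_isTailWeight_norm_sub_le (x := fun i => (x i : C(K, ℝ))) hM hx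
      (fun p i k => (hgb p k i).2) hglim (ε := fun p => 1 / ((p : ℝ) + 1))
      (fun p => by positivity) hFG n N (η := 1 / ((n : ℝ) + 1)) (by positivity)
  have hcoe : ∀ n, (((w n).linearCombination ℝ x : X) : C(K, ℝ)) =
      (w n).linearCombination ℝ fun i => (x i : C(K, ℝ)) := fun n =>
    Finsupp.apply_linearCombination ℝ X.subtype x (w n)
  -- The two monotone parts, bounded by `C` and `2 * C`, give `2 * C` and `4 * C`. The `4` comes
  -- from `m` coefficients of size at most `2 * S`, each with error at most `2 / (m + 1)`.
  refine ⟨fun n => (w n).linearCombination ℝ x, fun n => ?_, fun k => ?_, 6 * C + 4,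
    by positivity, fun m n hn hmn a S ha => ?_⟩
  · exact ((hw n).norm_linearCombination_le x).trans ((hw n).linearCombination_le fun i _ _ => hM i)
  · simp only [hcoe, linearCombination_continuousMap_apply]
    exact IsTailWeight.tendsto_linearCombination hN.tendsto_atTop hw (hx k)
  have hS0 : 0 ≤ S := (abs_nonneg _).trans (ha 0 (Nat.zero_le _))
  have ha2 : ∀ i ∈ Finset.range m, |a i| ≤ 2 * S := by
    intro i hi
    have h1 := abs_le.1 (ha i (Finset.mem_range.1 hi).le)
    have h2 := abs_le.1 (ha (i + 1) (Finset.mem_range.1 hi))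
    rw [Finset.sum_range_succ] at h2
    rw [abs_le]
    constructor <;> linarith [h1.1, h1.2, h2.1, h2.2]
  have hmain : ‖∑ i ∈ Finset.range m, a i • (w (n i)).linearCombination ℝ (g m)‖ ≤ 6 * C * S := by
    rw [ContinuousMap.norm_le _ (by positivity)]
    intro k
    obtain ⟨v, v', hv, hv', hvC, hvC', hgv⟩ := exists_monotone_sub_monotone
      (g := fun i => g m i k) (by rw [hg0]; rfl) fun N => (hgb m k N).1
    have h1 : (∑ i ∈ Finset.range m, a i • (w (n i)).linearCombination ℝ (g m)) k =
        ∑ i ∈ Finset.range m, a i * (w (n i)).linearCombination ℝ v -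
          ∑ i ∈ Finset.range m, a i * (w (n i)).linearCombination ℝ v' := by
      rw [ContinuousMap.sum_apply, ← Finset.sum_sub_distrib]
      refine Finset.sum_congr rfl fun i _ => ?_
      rw [ContinuousMap.smul_apply, linearCombination_continuousMap_apply, smul_eq_mul, ← mul_sub,
        ← Finsupp.linearCombination_sub_left]
      simp only [hgv]
    have h2 := abs_sum_mul_monotone_le
      ((monotone_linearCombination_of_successive hw hwN hv).comp hn.monotone)
      (fun i => (hw (n i)).le_linearCombination fun l _ _ => (hvC l).1)
      (fun i => (hw (n i)).linearCombination_le fun l _ _ => (hvC l).2) ha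
    have h3 := abs_sum_mul_monotone_le
      ((monotone_linearCombination_of_successive hw hwN hv').comp hn.monotone)
      (fun i => (hw (n i)).le_linearCombination fun l _ _ => (hvC' l).1)
      (fun i => (hw (n i)).linearCombination_le fun l _ _ => (hvC' l).2) ha
    simp only [Function.comp_apply] at h2 h3
    rw [h1, Real.norm_eq_abs]
    refine (abs_sub _ _).trans ?_
    linarith
  have herr : ‖∑ i ∈ Finset.range m, a i • ((w (n i)).linearCombination ℝ
      (fun l => (x l : C(K, ℝ))) - (w (n i)).linearCombination ℝ (g m))‖ ≤ 4 * S := by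
    refine (norm_sum_smul_le _ (M := 2 * (1 / ((m : ℝ) + 1))) (fun i _ => ?_) a).trans ?_
    · have hmi : m ≤ n i := hmn.trans (hn.monotone (Nat.zero_le i))
      refine (hQ (n i) m hmi).trans ?_
      have : 1 / ((n i : ℝ) + 1) ≤ 1 / ((m : ℝ) + 1) := by
        have : (m : ℝ) ≤ n i := by exact_mod_cast hmi
        gcongr
      linarith
    · have h1 : ∑ i ∈ Finset.range m, |a i| ≤ m * (2 * S) := by
        refine (Finset.sum_le_sum ha2).trans ?_
        simp
      have h2 : (m : ℝ) * (1 / ((m : ℝ) + 1)) ≤ 1 := by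
        rw [mul_one_div, div_le_one (by positivity)]; linarith
      calc (∑ i ∈ Finset.range m, |a i|) * (2 * (1 / ((m : ℝ) + 1)))
          ≤ m * (2 * S) * (2 * (1 / ((m : ℝ) + 1))) :=
            mul_le_mul_of_nonneg_right h1 (by positivity)
        _ = 4 * S * ((m : ℝ) * (1 / ((m : ℝ) + 1))) := by ring
        _ ≤ 4 * S := by nlinarith
  have hfin : ((∑ i ∈ Finset.range m, a i • (w (n i)).linearCombination ℝ x : X) : C(K, ℝ)) =
      ∑ i ∈ Finset.range m, a i • ((w (n i)).linearCombination ℝ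
        (fun l => (x l : C(K, ℝ))) - (w (n i)).linearCombination ℝ (g m)) +
      ∑ i ∈ Finset.range m, a i • (w (n i)).linearCombination ℝ (g m) := by
    rw [← Finset.sum_add_distrib, Submodule.coe_sum]
    refine Finset.sum_congr rfl fun i _ => ?_
    rw [Submodule.coe_smul, hcoe, ← smul_add, sub_add_cancel]
  have hnorm : ‖∑ i ∈ Finset.range m, a i • (w (n i)).linearCombination ℝ x‖ =
      ‖((∑ i ∈ Finset.range m, a i • (w (n i)).linearCombination ℝ x : X) : C(K, ℝ))‖ := rfl
  rw [hnorm, hfin]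
  refine (norm_add_le _ _).trans ?_
  linarith

end Blocks

/-! ### The main theorem -/

section Main

theorem norm_sum_ellOneBasis (n : ℕ) (a : ℕ → ℝ) :
    ‖∑ i ∈ Finset.range n, a i • ellOneBasis i‖ = ∑ i ∈ Finset.range n, |a i| := by
  have h := lp.norm_sum_single (E := fun _ : ℕ => ℝ) (p := 1) (by simp) a (Finset.range n)
  simp only [ENNReal.toReal_one, Real.rpow_one, Real.norm_eq_abs] at h
  rw [← h]
  congr 1
  refine Finset.sum_congr rfl fun i _ => ?_
  rw [ellOneBasis, ← lp.single_smul, smul_eq_mul, mul_one]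

theorem abs_sum_range_le_norm_sum_summingBasis (n : ℕ) (a : ℕ → ℝ) {j : ℕ} (hj : j ≤ n) :
    |∑ i ∈ Finset.range j, a i| ≤ ‖∑ i ∈ Finset.range n, a i • summingBasis i‖ := by
  cases j with
  | zero => simp
  | succ j =>
    rw [norm_sum_summingBasis]
    have h1 : ∑ i ∈ Finset.range (j + 1), a i = ∑ i ∈ Finset.range n with i ≤ j, a i := by
      refine Finset.sum_congr (Finset.ext fun i => ?_) fun _ _ => rfl
      simp only [Finset.mem_range, Finset.mem_filter]
      omega
    rw [h1]
    refine le_ciSup (f := fun k : ℕ => |∑ i ∈ Finset.range n with i ≤ k, a i|) ?_ j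
    refine ⟨∑ i ∈ Finset.range n, |a i|, ?_⟩
    rintro _ ⟨k, rfl⟩
    exact (Finset.abs_sum_le_sum_abs _ _).trans
      (Finset.sum_le_sum_of_subset_of_nonneg (Finset.filter_subset _ _) fun _ _ _ => abs_nonneg _)

theorem norm_sum_summingBasis_le {n : ℕ} {a : ℕ → ℝ} {B : ℝ}
    (h : ∀ j ≤ n, |∑ i ∈ Finset.range j, a i| ≤ B) :
    ‖∑ i ∈ Finset.range n, a i • summingBasis i‖ ≤ B := by
  rw [norm_sum_summingBasis]
  refine ciSup_le fun k => ?_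
  have h1 : ∑ i ∈ Finset.range n with i ≤ k, a i = ∑ i ∈ Finset.range (min n (k + 1)), a i := by
    refine Finset.sum_congr (Finset.ext fun i => ?_) fun _ _ => rfl
    simp only [Finset.mem_range, Finset.mem_filter]
    omega
  rw [h1]
  exact h _ (min_le_left _ _)

variable {K : Type*} [MetricSpace K] [CompactSpace K]

theorem BaireHalf.of_continuous {F : K → ℝ} (hF : Continuous F) : BaireHalf F := by
  refine ⟨⟨fun _ => ⟨F, hF⟩, ⟨‖(⟨F, hF⟩ : C(K, ℝ))‖, fun _ k =>
    (⟨F, hF⟩ : C(K, ℝ)).norm_coe_le_norm k⟩, fun k => tendsto_const_nhds⟩, fun _ => F,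
    fun _ => DBSC.of_continuous ⟨F, hF⟩, ?_⟩
  exact Metric.tendstoUniformly_iff.2 fun ε hε => Eventually.of_forall fun _ k => by simpa using hε

/-- A bounded sequence in a subspace of `C(K)` that converges pointwise to a discontinuous function
has a basic subsequence with a spreading model, whose norms dominate the summing basis and are
limits of norms of shifted combinations of the subsequence. -/
theorem exists_basic_subseq_spreadingModel {X : Submodule ℝ C(K, ℝ)} {F : K → ℝ}
    (hF : ¬ Continuous F) {x : ℕ → X} {M : ℝ} (hM : ∀ n, ‖x n‖ ≤ M)
    (hx : ∀ k, Tendsto (fun n => (x n : C(K, ℝ)) k) atTop (𝓝 (F k))) :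
    ∃ φ : ℕ → ℕ, StrictMono φ ∧ ∃ (S : Type) (_ : NormedAddCommGroup S) (_ : NormedSpace ℝ S)
      (_ : CompleteSpace S) (e : ℕ → S), IsSpreadingModel (x ∘ φ) e ∧
      (∃ C > 0, ∀ (a : ℕ → ℝ) (m N : ℕ), m ≤ N →
        |∑ i ∈ Finset.range m, a i| ≤ C * ‖∑ i ∈ Finset.range N, a i • e i‖) ∧
      ∀ (a : ℕ → ℝ) (m : ℕ), Tendsto (fun N => ‖∑ i ∈ Finset.range m, a i • x (φ (N + i))‖)
        (hyperfilter ℕ : Filter ℕ) (𝓝 ‖∑ i ∈ Finset.range m, a i • e i‖) := by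
  obtain ⟨φ, hφ, C, hC, hsum, hpre⟩ :=
    exists_strictMono_prefixBound hF (x := fun n => (x n : C(K, ℝ))) hM hx
  have hcoe : ∀ (a : ℕ → ℝ) (N : ℕ) (n : ℕ → ℕ), ‖∑ i ∈ Finset.range N, a i • x (n i)‖ =
      ‖∑ i ∈ Finset.range N, a i • (x (n i) : C(K, ℝ))‖ := fun a N n => by
    rw [← Submodule.norm_coe, Submodule.coe_sum]
    rfl
  have hpre' : PrefixBound (x ∘ φ) C := fun a m N hmN => by
    simp only [Function.comp_apply]
    rw [hcoe, hcoe]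
    exact hpre a m N hmN
  have hsum' : ∀ (ψ : ℕ → ℕ), StrictMono ψ → ∀ (a : ℕ → ℝ) (m N : ℕ), m ≤ N →
      |∑ i ∈ Finset.range m, a i| ≤ C * ‖∑ i ∈ Finset.range N, a i • x (φ (ψ i))‖ := by
    intro ψ hψ a m N hmN
    have h1 := sum_range_comp_eq_sum_extend hψ (fun _ => (1 : ℝ)) a m
    simp only [smul_eq_mul, mul_one] at h1
    rw [hcoe, h1, sum_range_comp_eq_sum_extend hψ fun i => (x (φ i) : C(K, ℝ))]
    exact hsum _ _ _ (hψ.monotone hmN)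
  have hlow : ∀ n, C⁻¹ ≤ ‖(x ∘ φ) n‖ := by
    intro n
    have h1 := hsum' (fun i => n + i) (fun i j hij => by simpa using hij) (fun _ => 1) 1 1 le_rfl
    simp only [Finset.range_one, Finset.sum_singleton, abs_one, one_smul, add_zero] at h1
    rw [inv_eq_one_div, div_le_iff₀' hC]
    exact h1
  obtain ⟨ψ, hψ, S, i1, i2, i3, e, he, hlim⟩ :=
    exists_spreadingModel (x := x ∘ φ) (fun n => hM (φ n)) (inv_pos.2 hC) hlow hpre'
  refine ⟨φ ∘ ψ, hφ.comp hψ, S, i1, i2, i3, e, he, ⟨C, hC, fun a m N hmN => ?_⟩, hlim⟩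
  exact ge_of_tendsto' ((hlim a N).const_mul C) fun n =>
    hsum' (fun i => ψ (n + i)) (hψ.comp fun i j hij => by simpa using hij) a m N hmN

end Main

end

theorem corollary3p10 {K : Type*} [MetricSpace K] [CompactSpace K]
    (X : Submodule ℝ C(K, ℝ)) (hX : IsClosed (X : Set C(K, ℝ))) :
    ((∃ F : K → ℝ, MemBidual X F ∧ BaireOne F ∧ ¬ BaireHalf F) →
      ∃ x : ℕ → X, IsBasicSequence x ∧ HasSpreadingModelEquivalentTo x ellOneBasis) ∧
    ((∃ F : K → ℝ, MemBidual X F ∧ BaireQuarter F ∧ ¬ ∃ g ∈ X, F = ⇑g) →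
      ∃ x : ℕ → X, IsBasicSequence x ∧ HasSpreadingModelEquivalentTo x summingBasis) := by
  constructor
  · rintro ⟨F, hmem, hF1, hF2⟩
    obtain ⟨x, M, hM, hx⟩ := hmem.exists_seq
    obtain ⟨φ, hφ, δ, hδ, hlow⟩ := exists_strictMono_late_ellOne hF1 hF2 hx
    obtain ⟨ψ, hψ, S, i1, i2, i3, e, he, -, hlim⟩ := exists_basic_subseq_spreadingModel
      (fun h => hF2 (BaireHalf.of_continuous h)) (x := x ∘ φ) (fun n => hM (φ n))
      (fun k => (hx k).comp hφ.tendsto_atTop)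
    refine ⟨(x ∘ φ) ∘ ψ, he.basic_left, S, i1, i2, i3, e, he, δ, max M 1, hδ,
      lt_max_of_lt_right one_pos, fun n a => ?_⟩
    rw [norm_sum_ellOneBasis]
    constructor
    · refine ge_of_tendsto (hlim a n) ?_
      -- A shift by `N ≥ n` makes the piece late enough, since its first index is `ψ N ≥ N ≥ n`.
      filter_upwards [Nat.hyperfilter_le_atTop (eventually_ge_atTop n)] with N hN
      have h1 := hlow n (fun i => ψ (N + i)) (hψ.comp fun i j hij => by simpa using hij)
        (hN.trans hψ.le_apply) a
      refine h1.trans (le_of_eq ?_)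
      rw [← Submodule.norm_coe, Submodule.coe_sum]
      rfl
    · refine le_of_tendsto' (hlim a n) fun N => ?_
      rw [mul_comm]
      exact norm_sum_smul_le _ (fun i _ => (hM _).trans (le_max_left _ _)) a
  · rintro ⟨F, hmem, hF, hFX⟩
    obtain ⟨x, M, hM, hx⟩ := hmem.exists_seq
    -- Closedness of `X` is used here: a continuous bounded pointwise limit of elements of `X` is a
    -- norm limit of their convex combinations.
    have hcont : ¬ Continuous F := fun h =>
      hFX ⟨⟨F, h⟩, mem_of_tendsto_pointwise hX hM (g := ⟨F, h⟩) hx, rfl⟩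
    obtain ⟨h, hhM, hhx, C, hC, hup⟩ := hF.exists_late_summing_upper hM hx
    obtain ⟨ψ, hψ, S, i1, i2, i3, e, he, ⟨D, hD, hdom⟩, hlim⟩ :=
      exists_basic_subseq_spreadingModel hcont hhM hhx
    refine ⟨h ∘ ψ, he.basic_left, S, i1, i2, i3, e, he, D⁻¹, C, inv_pos.2 hD, hC,
      fun n a => ⟨?_, ?_⟩⟩
    · rw [inv_mul_le_iff₀ hD]
      exact norm_sum_summingBasis_le fun j hj => hdom a j n hj
    · refine le_of_tendsto (hlim a n) ?_
      filter_upwards [Nat.hyperfilter_le_atTop (eventually_ge_atTop n)] with N hN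
      exact hup n (fun i => ψ (N + i)) (hψ.comp fun i j hij => by simpa using hij)
        (hN.trans hψ.le_apply) a _ fun j hj => abs_sum_range_le_norm_sum_summingBasis n a hj
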